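/- **Setting.** Let $(X,\mathfrak g)$ and $(Y,\mathfrak h)$ be smooth oriented Riemannian surfaces without boundary (Hausdorff, second countable). Let $\mathcal M\subset X$ be a compact connected surface, possibly with boundary; precisely, $\mathcal M$ is compact, it is the closure of its interior $\mathcal M^\circ$, the interior is connected, and $\partial\mathcal M$ has zero area (this includes closed surfaces and compact connected surfaces with Lipschitz boundary). Let $\mathcal N\subset Y$ be any subset (for example a compact surface with Lipschitz boundary). For a linear map $A$ between oriented Euclidean planes $V,W$ let $\sigma_1(A)\ge\sigma_2(A)\ge 0$ be its singular values, $\det A$ its determinant with respect to positively oriented orthonormal bases, $|A|=\sqrt{\operatorname{tr}(A^TA)}$, and $\operatorname{dist}(A,\operatorname{SO})=\inf_Q|A-Q|$, where $Q$ runs over the orientation-preserving linear isometries $V\to W$. Let $$K=\{A : \det A\ge 0,\ \sigma_1(A)+\sigma_2(A)=1\}.$$ For $p>0$ and a map $\phi:\mathcal M\to\mathcal N$ put $J\phi=\det d\phi$ and $$E_p(\phi)=\frac{1}{\operatorname{Vol}_{\mathfrak g}(\mathcal M)}\int_{\mathcal M}\operatorname{dist}^p(d\phi,\operatorname{SO})\,\operatorname{Vol}_{\mathfrak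 g}.$$ A $C^2$ map $\phi:\mathcal M\to\mathcal N$ is a *critical point* of $E_p$ if $t\mapsto E_p(\phi_t)$ is differentiable at $t=0$ with $\frac{d}{dt}\big|_{t=0}E_p(\phi_t)=0$ for every family of maps $\phi_t:\mathcal M\to\mathcal N$, $|t|<\varepsilon$, that is jointly $C^2$ in $(t,x)$, has $\phi_0=\phi$, and satisfies $\phi_t=\phi$ outside a fixed compact subset of $\mathcal M^\circ$. **Proposition 1.6.** Let $\phi:\mathcal M\to\mathcal N$ be a $C^2$ map such that $J\phi>0$ and $d\phi\in K$ at every point of $\mathcal M^\circ$. Then $\phi$ is a critical point of $E_2$. Moreover, for every real $p>0$ with $p\ne 2$, $\phi$ is a critical point of $E_p$ if and only if its singular values $\sigma_1(d\phi)$, $\sigma_2(d\phi)$ are constant on $\mathcal M^\circ$. -/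

import Mathlib

open Set MeasureTheory Module
open scoped Manifold ContDiff Topology Bundle

noncomputable section

namespace SurfaceElasticity

/-! ### Linear maps between oriented Euclidean planes -/

section Plane

variable {V W : Type*} [NormedAddCommGroup V] [InnerProductSpace ℝ V] [Fact (finrank ℝ V = 2)]
  [NormedAddCommGroup W] [InnerProductSpace ℝ W] [Fact (finrank ℝ W = 2)]

theorem finiteDimensional_of_plane (V : Type*) [NormedAddCommGroup V] [InnerProductSpace ℝ V]
    [Fact (finrank ℝ V = 2)] : FiniteDimensional ℝ V :=
  FiniteDimensional.of_fact_finrank_eq_two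

/-- The determinant (signed Jacobian) of a linear map between oriented Euclidean planes: the area
form of the target evaluated on the image of a positively oriented orthonormal basis. -/
def jac (o : Orientation ℝ V (Fin 2)) (o' : Orientation ℝ W (Fin 2)) (A : V →ₗ[ℝ] W) : ℝ :=
  o'.volumeForm fun i => A (o.finOrthonormalBasis two_pos Fact.out i)

/-- Orientation preserving linear isometries between two oriented Euclidean planes. -/
def SO (o : Orientation ℝ V (Fin 2)) (o' : Orientation ℝ W (Fin 2)) : Set (V →ₗ[ℝ] W) :=
  {Q | (∀ v, ‖Q v‖ = ‖v‖) ∧ 0 < jac o o' Q}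

/-- The norm `√(tr (AᵀA))` on `Hom(V, W)` that comes from the inner product induced by those of
`V` and `W`. -/
def frobeniusNorm (A : V →ₗ[ℝ] W) : ℝ :=
  haveI := finiteDimensional_of_plane V
  haveI := finiteDimensional_of_plane W
  √(LinearMap.trace ℝ V (LinearMap.adjoint A ∘ₗ A))

/-- The distance from `A` to the set of orientation preserving linear isometries. -/
def distSO (o : Orientation ℝ V (Fin 2)) (o' : Orientation ℝ W (Fin 2)) (A : V →ₗ[ℝ] W) : ℝ :=
  ⨅ Q : SO o o', frobeniusNorm (A - Q.1)

/-- The singular values of `A`; index `0` is the larger one and index `1` the smaller one. -/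
def singVal (A : V →ₗ[ℝ] W) (i : Fin 2) : ℝ :=
  haveI := finiteDimensional_of_plane V
  haveI := finiteDimensional_of_plane W
  A.singularValues i

/-- The well `K`: maps of non-negative determinant whose singular values sum to `1`. -/
def wellK (o : Orientation ℝ V (Fin 2)) (o' : Orientation ℝ W (Fin 2)) : Set (V →ₗ[ℝ] W) :=
  {A | 0 ≤ jac o o' A ∧ singVal A 0 + singVal A 1 = 1}

end Plane

/-! ### Oriented Riemannian surfaces -/

/-- The model plane of a surface. -/
abbrev Plane : Type := EuclideanSpace ℝ (Fin 2)

section Surface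

variable {X : Type*} [TopologicalSpace X] [ChartedSpace Plane X] [IsManifold (𝓡 2) ∞ X]
  [Bundle.RiemannianBundle (fun x : X => TangentSpace (𝓡 2) x)]

instance instFactFinrankTangent (x : X) : Fact (finrank ℝ (TangentSpace (𝓡 2) x) = 2) :=
  ⟨(finrank_euclideanSpace_fin : finrank ℝ Plane = 2)⟩

/-- The coordinate vector fields `∂₁, ∂₂` of the preferred chart at `x₀`, at the point with
coordinates `u`. -/
def coordFrame (x₀ : X) (u : Plane) (i : Fin 2) :
    TangentSpace (𝓡 2) ((chartAt Plane x₀).symm u) :=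
  mfderiv (𝓡 2) (𝓡 2) (chartAt Plane x₀).symm u
    (EuclideanSpace.single i (1 : ℝ) : Plane)

/-- The measure `√(det g) du₁ du₂` of the preferred chart at `x₀`, carried by the domain of that
chart. -/
def chartVolume [MeasurableSpace X] (x₀ : X) : Measure X :=
  ((volume.restrict (chartAt Plane x₀).target).withDensity
    fun u => ENNReal.ofReal √(Matrix.gram ℝ (coordFrame x₀ u)).det).map (chartAt Plane x₀).symm

/-- The Riemannian area measure. The measures `√(det g) du₁ du₂` of two charts agree on the
overlap of their domains, and (for a second countable surface) the least measure above all of them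
is the one that restricts to `√(det g) du₁ du₂` on the domain of each chart. -/
def riemannianVolume (X : Type*) [TopologicalSpace X] [ChartedSpace Plane X]
    [IsManifold (𝓡 2) ∞ X] [Bundle.RiemannianBundle (fun x : X => TangentSpace (𝓡 2) x)]
    [MeasurableSpace X] : Measure X :=
  ⨆ x₀ : X, chartVolume x₀

/-- An orientation of a Riemannian surface: orientations of all the tangent planes, such that the
oriented area form is a continuous 2-form, that is, its component
`vol(∂₁, ∂₂) = ± √(det g)` is continuous in each chart. -/
structure SurfaceOrientation (X : Type*) [TopologicalSpace X] [ChartedSpace Plane X]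
    [IsManifold (𝓡 2) ∞ X] [Bundle.RiemannianBundle (fun x : X => TangentSpace (𝓡 2) x)] where
  at_point : ∀ x : X, Orientation ℝ (TangentSpace (𝓡 2) x) (Fin 2)
  continuousOn_volumeForm : ∀ x₀ : X, ContinuousOn
    (fun u : Plane =>
      (at_point ((chartAt Plane x₀).symm u)).volumeForm (coordFrame x₀ u))
    (chartAt Plane x₀).target

end Surface

/-! ### The energy and its critical points -/

section Energy

variable {X : Type*} [TopologicalSpace X] [ChartedSpace Plane X] [IsManifold (𝓡 2) ∞ X]
  [Bundle.RiemannianBundle (fun x : X => TangentSpace (𝓡 2) x)] [MeasurableSpace X]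
  {Y : Type*} [TopologicalSpace Y] [ChartedSpace Plane Y] [IsManifold (𝓡 2) ∞ Y]
  [Bundle.RiemannianBundle (fun y : Y => TangentSpace (𝓡 2) y)]

/-- A compact connected surface with boundary, realised as a subset of a surface without boundary:
it is the closure of its interior, the interior is connected, and the boundary has zero area.
Closed surfaces (`M = univ`) and compact connected surfaces with Lipschitz boundary are of this
kind. -/
structure IsCompactSurface (M : Set X) : Prop where
  isCompact : IsCompact M
  closure_interior : closure (interior M) = M
  isConnected_interior : IsConnected (interior M)
  volume_frontier : riemannianVolume X (frontier M) = 0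

/-- The differential of a map between surfaces, as a linear map. -/
abbrev diff (φ : X → Y) (x : X) : TangentSpace (𝓡 2) x →ₗ[ℝ] TangentSpace (𝓡 2) (φ x) :=
  (mfderiv (𝓡 2) (𝓡 2) φ x).toLinearMap

/-- The energy `E_p(φ)`: the average over `M` of `dist^p(dφ, SO)`. -/
def energy (oX : SurfaceOrientation X) (oY : SurfaceOrientation Y) (M : Set X) (p : ℝ)
    (φ : X → Y) : ℝ :=
  ⨍ x in M, distSO (oX.at_point x) (oY.at_point (φ x)) (diff φ x) ^ p ∂(riemannianVolume X)

/-- A `C²` variation `Φ t`, `|t| < ε`, of a map `φ : M → N`, through maps `M → N` that agree with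
`φ` outside a fixed compact subset of the interior of `M`. -/
structure IsVariation (M : Set X) (N : Set Y) (φ : X → Y) (ε : ℝ) (Φ : ℝ → X → Y) : Prop where
  pos : 0 < ε
  contMDiffOn : ContMDiffOn (𝓘(ℝ, ℝ).prod (𝓡 2)) (𝓡 2) 2 (fun q : ℝ × X => Φ q.1 q.2)
    (Ioo (-ε) ε ×ˢ M)
  mapsTo : ∀ t ∈ Ioo (-ε) ε, MapsTo (Φ t) M N
  zero : ∀ x ∈ M, Φ 0 x = φ x
  eq_outside : ∃ C : Set X, IsCompact C ∧ C ⊆ interior M ∧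
    ∀ t ∈ Ioo (-ε) ε, ∀ x ∈ M \ C, Φ t x = φ x

/-- `φ : M → N` is a critical point of `E_p`: the energy has vanishing derivative along every
`C²` variation of `φ` with compact support in the interior of `M`. -/
def IsCriticalPoint (oX : SurfaceOrientation X) (oY : SurfaceOrientation Y) (M : Set X) (N : Set Y)
    (p : ℝ) (φ : X → Y) : Prop :=
  ∀ (ε : ℝ) (Φ : ℝ → X → Y), IsVariation M N φ ε Φ →
    HasDerivAt (fun t => energy oX oY M p (Φ t)) 0 0

/-- The two singular values of `dφ` are constant on the interior of `M`. -/
def HasConstantSingularValues (M : Set X) (φ : X → Y) : Prop :=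
  ∃ s : Fin 2 → ℝ, ∀ x ∈ interior M, ∀ i, singVal (diff φ x) i = s i

end Energy

end SurfaceElasticity

end

/-! The squared distance of `A` to the rotations is `|A|² + 2 - 2√(|A|² + 2 det A)` (`distSO_eq`).
On the well the radicand is `(σ₁ + σ₂)² = 1`, so the derivative of the square root there is `1/2`
and the variations of `|A|²` cancel: the first variation of `dist²` is `-2` times that of the
Jacobian `J`. Since `dist² = 1 - 2J` on the well, the density `dist^p` has first variation `-p (1 -
2J)^(p/2 - 1) J'` (`hasDerivAt_energyDensity`). The bound `J ≤ 1/4` keeps the base at least `1/2`,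
so all powers are smooth near `t = 0` and the integral may be differentiated (`hasDerivAt_energy`).

The Jacobian is a null Lagrangian. The pull-back of the area form under `(t, u) ↦ Φ t u` is closed,
and its `(dt, du)` components form a flux whose divergence is the variation of `J √g du₀ du₁`
(`hasDerivAt_pullbackArea`). This flux is compactly supported, so `∫ J' = 0`
(`setIntegral_jacVariation_eq_zero`). Hence `φ` is critical whenever the weight `(1 - 2J)^(p/2 - 1)`
is constant: always for `p = 2`, and for every `p` when the singular values, hence `J = σ₁σ₂`, are
constant.

Conversely, let `φ` be critical for some `p ≠ 2`. Precompose it with `u ↦ u + t h(u) eᵢ` in a chart;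
such variations remain in any target set `N`. Their flux is `h J √g eᵢ` up to sign, and integration
by parts gives `∫ h ∂ᵢG J √g = 0` for the weight `G` and every test function `h`
(`integral_fderiv_weight_eq_zero`). As `J > 0`, the gradient of `G` vanishes. A nonzero power is
injective on positive numbers, so `J` is locally constant, and constant because the interior is
connected. The singular values are the roots of `s² - s + J`. -/

set_option linter.unusedSectionVars false

noncomputable section

namespace SurfaceElasticity

/-! ### Linear algebra of maps between oriented Euclidean planes -/

section PlaneAlgebra

variable {V W : Type*} [NormedAddCommGroup V] [InnerProductSpace ℝ V] [Fact (finrank ℝ V = 2)]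
  [NormedAddCommGroup W] [InnerProductSpace ℝ W] [Fact (finrank ℝ W = 2)]
  (o : Orientation ℝ V (Fin 2)) (o' : Orientation ℝ W (Fin 2))

/-- A positively oriented orthonormal basis. -/
abbrev orthoBasis : OrthonormalBasis (Fin 2) ℝ V := o.finOrthonormalBasis two_pos Fact.out

theorem volumeForm_orthoBasis : o.volumeForm ![orthoBasis o 0, orthoBasis o 1] = 1 := by
  rw [o.volumeForm_robust (orthoBasis o) (o.finOrthonormalBasis_orientation two_pos Fact.out)]
  have : ![orthoBasis o 0, orthoBasis o 1] = (orthoBasis o).toBasis := by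
    ext i; fin_cases i <;> simp
  rw [this, Basis.det_self]

theorem areaForm_orthoBasis : o.areaForm (orthoBasis o 0) (orthoBasis o 1) = 1 := by
  rw [o.areaForm_to_volumeForm, volumeForm_orthoBasis]

theorem jac_eq_areaForm (A : V →ₗ[ℝ] W) :
    jac o o' A = o'.areaForm (A (orthoBasis o 0)) (A (orthoBasis o 1)) := by
  rw [jac, o'.areaForm_to_volumeForm]
  congr 1
  ext i; fin_cases i <;> rfl

theorem exists_orthoBasis_coords (v : V) : ∃ a b : ℝ, v = a • orthoBasis o 0 + b • orthoBasis o 1 :=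
  ⟨_, _, by simpa [Fin.sum_univ_two] using ((orthoBasis o).sum_repr v).symm⟩

/-- Both sides are alternating and bilinear in `v, w` and agree on an orthonormal basis. This lets
the Jacobian be read off from a coordinate frame. -/
theorem jac_mul_areaForm (A : V →ₗ[ℝ] W) (v w : V) :
    jac o o' A * o.areaForm v w = o'.areaForm (A v) (A w) := by
  obtain ⟨a, b, rfl⟩ := exists_orthoBasis_coords o v
  obtain ⟨c, d, rfl⟩ := exists_orthoBasis_coords o w
  rw [jac_eq_areaForm]
  have h1 := areaForm_orthoBasis o
  have h2 := o.areaForm_swap (orthoBasis o 1) (orthoBasis o 0)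
  have h3 := o'.areaForm_swap (A (orthoBasis o 1)) (A (orthoBasis o 0))
  simp only [map_add, map_smul, LinearMap.add_apply, LinearMap.smul_apply, smul_eq_mul,
    Orientation.areaForm_apply_self, h2, h3, h1]
  ring

theorem frobeniusNorm_sq (b : OrthonormalBasis (Fin 2) ℝ V) (A : V →ₗ[ℝ] W) :
    frobeniusNorm A ^ 2 = ‖A (b 0)‖ ^ 2 + ‖A (b 1)‖ ^ 2 := by
  have := finiteDimensional_of_plane V
  have := finiteDimensional_of_plane W
  have : LinearMap.trace ℝ V (LinearMap.adjoint A ∘ₗ A) = ‖A (b 0)‖ ^ 2 + ‖A (b 1)‖ ^ 2 := by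
    rw [LinearMap.trace_eq_sum_inner _ b]
    simp [Fin.sum_univ_two, LinearMap.adjoint_inner_right]
  rw [frobeniusNorm, this, Real.sq_sqrt (by positivity)]

theorem frobeniusNorm_nonneg (A : V →ₗ[ℝ] W) : 0 ≤ frobeniusNorm A := Real.sqrt_nonneg _

theorem inner_orthoBasis : inner ℝ (orthoBasis o 0) (orthoBasis o 1) = 0 ∧
    inner ℝ (orthoBasis o 1) (orthoBasis o 0) = 0 :=
  ⟨(orthoBasis o).orthonormal.2 (by decide), (orthoBasis o).orthonormal.2 (by decide)⟩

/-- This is `|A|² = tr(G⁻¹H)` for the Gram matrices `G` of `v, w` and `H` of `A v, A w`, with the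
denominator `det G = area²` cleared. It serves for frames that are not orthonormal. -/
theorem frobeniusNorm_sq_mul_areaForm_sq (A : V →ₗ[ℝ] W) (v w : V) :
    frobeniusNorm A ^ 2 * o.areaForm v w ^ 2 =
      inner ℝ w w * inner ℝ (A v) (A v) - 2 * inner ℝ v w * inner ℝ (A v) (A w) +
        inner ℝ v v * inner ℝ (A w) (A w) := by
  rw [frobeniusNorm_sq (orthoBasis o)]
  obtain ⟨a, b, rfl⟩ := exists_orthoBasis_coords o v
  obtain ⟨c, d, rfl⟩ := exists_orthoBasis_coords o w
  have h1 := areaForm_orthoBasis o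
  have h2 := o.areaForm_swap (orthoBasis o 1) (orthoBasis o 0)
  have h3 := real_inner_comm (A (orthoBasis o 1)) (A (orthoBasis o 0))
  have h4 := inner_orthoBasis o
  simp only [← real_inner_self_eq_norm_sq, map_add, map_smul, LinearMap.add_apply,
    LinearMap.smul_apply, smul_eq_mul, inner_add_left, inner_add_right, real_inner_smul_left,
    real_inner_smul_right, Orientation.areaForm_apply_self, h2, h3, h1, h4.1, h4.2]
  simp only [real_inner_self_eq_norm_sq, OrthonormalBasis.norm_eq_one]
  ring

theorem areaForm_sq_eq (v w : V) :
    o.areaForm v w ^ 2 = ‖v‖ ^ 2 * ‖w‖ ^ 2 - inner ℝ v w ^ 2 := by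
  linarith [o.inner_sq_add_areaForm_sq v w]

theorem norm_add_rotation_sq (a b : W) :
    ‖a - o'.rightAngleRotation b‖ ^ 2 = ‖a‖ ^ 2 + ‖b‖ ^ 2 + 2 * o'.areaForm a b := by
  rw [norm_sub_sq_real, o'.inner_rightAngleRotation_right, LinearIsometryEquiv.norm_map]
  ring

/-- With the rotation by a right angle as multiplication by `i`, the vector on the right is twice
the complex linear part of `A`. -/
theorem frobeniusNorm_sq_add_two_mul_jac (A : V →ₗ[ℝ] W) :
    frobeniusNorm A ^ 2 + 2 * jac o o' A =
      ‖A (orthoBasis o 0) - o'.rightAngleRotation (A (orthoBasis o 1))‖ ^ 2 := by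
  rw [norm_add_rotation_sq, frobeniusNorm_sq (orthoBasis o), jac_eq_areaForm]

theorem frobeniusNorm_sq_add_two_mul_jac_nonneg (A : V →ₗ[ℝ] W) :
    0 ≤ frobeniusNorm A ^ 2 + 2 * jac o o' A := by
  rw [frobeniusNorm_sq_add_two_mul_jac]; positivity

/-- The rotation that sends the first vector of the orthonormal basis to `q`. -/
def rotationTo (q : W) : V →ₗ[ℝ] W :=
  (orthoBasis o).toBasis.constr ℝ ![q, o'.rightAngleRotation q]

@[simp] theorem rotationTo_zero (q : W) : rotationTo o o' q (orthoBasis o 0) = q := by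
  have h := (orthoBasis o).toBasis.constr_basis ℝ ![q, o'.rightAngleRotation q] 0
  rwa [OrthonormalBasis.coe_toBasis] at h

@[simp] theorem rotationTo_one (q : W) :
    rotationTo o o' q (orthoBasis o 1) = o'.rightAngleRotation q := by
  have h := (orthoBasis o).toBasis.constr_basis ℝ ![q, o'.rightAngleRotation q] 1
  rwa [OrthonormalBasis.coe_toBasis] at h

theorem rotationTo_mem_SO {q : W} (hq : ‖q‖ = 1) : rotationTo o o' q ∈ SO o o' := by
  constructor
  · intro v
    obtain ⟨a, b, rfl⟩ := exists_orthoBasis_coords o v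
    rw [← sq_eq_sq₀ (norm_nonneg _) (norm_nonneg _)]
    have h4 := inner_orthoBasis o
    simp only [map_add, map_smul, rotationTo_zero, rotationTo_one, ← real_inner_self_eq_norm_sq,
      inner_add_left, inner_add_right, real_inner_smul_left, real_inner_smul_right, h4.1, h4.2,
      o'.inner_rightAngleRotation_left, o'.inner_rightAngleRotation_right,
      o'.areaForm_apply_self]
    simp [hq]
  · rw [jac_eq_areaForm, rotationTo_zero, rotationTo_one, o'.areaForm_rightAngleRotation_right,
      real_inner_self_eq_norm_sq, hq]
    norm_num

/-- The images of the basis are orthonormal, so `jac² = 1`, and the sign condition selects `jac =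
1`. Thus minimising over rotations is minimising over a unit circle. -/
theorem SO_apply_one {Q : V →ₗ[ℝ] W} (hQ : Q ∈ SO o o') :
    ‖Q (orthoBasis o 0)‖ = 1 ∧
      Q (orthoBasis o 1) = o'.rightAngleRotation (Q (orthoBasis o 0)) := by
  obtain ⟨h, hp⟩ := hQ
  have h0 : ‖Q (orthoBasis o 0)‖ = 1 := by simp [h]
  have h1 : ‖Q (orthoBasis o 1)‖ = 1 := by simp [h]
  have hin : inner ℝ (Q (orthoBasis o 0)) (Q (orthoBasis o 1)) = 0 := by
    have h2 := h (orthoBasis o 0 + orthoBasis o 1)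
    rw [← sq_eq_sq₀ (norm_nonneg _) (norm_nonneg _), map_add, norm_add_sq_real, norm_add_sq_real,
      (inner_orthoBasis o).1, h0, h1] at h2
    simp at h2
    linarith
  have har := o'.inner_sq_add_areaForm_sq (Q (orthoBasis o 0)) (Q (orthoBasis o 1))
  rw [← jac_eq_areaForm, hin, h0, h1] at har
  have hj : jac o o' Q = 1 := by nlinarith
  refine ⟨h0, ?_⟩
  rw [← sub_eq_zero, ← norm_eq_zero, ← sq_eq_zero_iff, norm_sub_sq_real,
    o'.inner_rightAngleRotation_right, LinearIsometryEquiv.norm_map, h0, h1, o'.areaForm_swap,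
    ← jac_eq_areaForm, hj]
  norm_num

/-- `Q` is determined by its first column, so the cross term `tr(AᵀQ)` collapses to one inner
product with that column. -/
theorem frobeniusNorm_sub_SO_sq (A : V →ₗ[ℝ] W) {Q : V →ₗ[ℝ] W} (hQ : Q ∈ SO o o') :
    frobeniusNorm (A - Q) ^ 2 = frobeniusNorm A ^ 2 + 2 -
      2 * inner ℝ (A (orthoBasis o 0) - o'.rightAngleRotation (A (orthoBasis o 1)))
        (Q (orthoBasis o 0)) := by
  obtain ⟨h0, h1⟩ := SO_apply_one o o' hQ
  rw [frobeniusNorm_sq (orthoBasis o), frobeniusNorm_sq (orthoBasis o), LinearMap.sub_apply,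
    LinearMap.sub_apply, norm_sub_sq_real, norm_sub_sq_real, h1, inner_sub_left,
    o'.inner_rightAngleRotation_right, o'.inner_rightAngleRotation_left,
    LinearIsometryEquiv.norm_map, h0]
  ring

/-- The distance to the rotations in terms of the norm and the Jacobian. -/
theorem distSO_eq (A : V →ₗ[ℝ] W) :
    distSO o o' A = √(frobeniusNorm A ^ 2 + 2 - 2 * √(frobeniusNorm A ^ 2 + 2 * jac o o' A)) := by
  set z := A (orthoBasis o 0) - o'.rightAngleRotation (A (orthoBasis o 1)) with hz
  have hs : √(frobeniusNorm A ^ 2 + 2 * jac o o' A) = ‖z‖ := by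
    rw [frobeniusNorm_sq_add_two_mul_jac, Real.sqrt_sq (norm_nonneg _)]
  have hle : ∀ Q : SO o o',
      √(frobeniusNorm A ^ 2 + 2 - 2 * ‖z‖) ≤ frobeniusNorm (A - Q.1) := by
    intro Q
    refine Real.sqrt_le_iff.2 ⟨frobeniusNorm_nonneg _, ?_⟩
    rw [frobeniusNorm_sub_SO_sq o o' A Q.2]
    have h1 := real_inner_le_norm z (Q.1 (orthoBasis o 0))
    rw [(SO_apply_one o o' Q.2).1] at h1
    linarith
  -- Equality in Cauchy–Schwarz: the nearest rotation has first column `z / ‖z‖`, and any unit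
  -- vector will do when `z = 0`.
  obtain ⟨q, hq, hqz⟩ : ∃ q : W, ‖q‖ = 1 ∧ inner ℝ z q = ‖z‖ := by
    by_cases hz0 : z = 0
    · have : Nontrivial W :=
        Module.nontrivial_of_finrank_pos (R := ℝ) (by rw [Fact.out (p := finrank ℝ W = 2)]; simp)
      obtain ⟨q, hq⟩ := exists_norm_eq W (zero_le_one : (0 : ℝ) ≤ 1)
      exact ⟨q, hq, by simp [hz0]⟩
    · have := norm_ne_zero_iff.2 hz0
      refine ⟨‖z‖⁻¹ • z, by rw [norm_smul]; simp [this], ?_⟩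
      rw [real_inner_smul_right, real_inner_self_eq_norm_sq]
      field_simp
  have hmem := rotationTo_mem_SO o o' hq
  have : Nonempty (SO o o') := ⟨⟨_, hmem⟩⟩
  rw [hs]
  refine le_antisymm ?_ (le_ciInf hle)
  refine (ciInf_le ⟨0, ?_⟩ ⟨rotationTo o o' q, hmem⟩).trans (le_of_eq ?_)
  · rintro _ ⟨Q, rfl⟩
    exact frobeniusNorm_nonneg _
  · rw [← Real.sqrt_sq (frobeniusNorm_nonneg (A - rotationTo o o' q)),
      frobeniusNorm_sub_SO_sq o o' A hmem, rotationTo_zero, hqz]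

theorem singVal_sq_add (A : V →ₗ[ℝ] W) : singVal A 0 ^ 2 + singVal A 1 ^ 2 = frobeniusNorm A ^ 2 := by
  have := finiteDimensional_of_plane V
  have := finiteDimensional_of_plane W
  have h2 : finrank ℝ V = 2 := Fact.out
  have ht := A.isSymmetric_adjoint_comp_self.trace_eq_sum_eigenvalues h2
  have hpos : 0 ≤ LinearMap.trace ℝ V (LinearMap.adjoint A ∘ₗ A) := by
    rw [LinearMap.trace_eq_sum_inner _ (stdOrthonormalBasis ℝ V)]
    refine Finset.sum_nonneg fun i _ => ?_
    simp [LinearMap.adjoint_inner_right]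
  rw [frobeniusNorm, Real.sq_sqrt hpos, ht, Fin.sum_univ_two]
  simp only [singVal]
  have h0 := A.sq_singularValues_fin h2 0
  have h1 := A.sq_singularValues_fin h2 1
  simp at h0 h1 ⊢
  rw [h0, h1]

theorem singVal_nonneg (A : V →ₗ[ℝ] W) (i : Fin 2) : 0 ≤ singVal A i := by
  have := finiteDimensional_of_plane V
  have := finiteDimensional_of_plane W
  exact A.singularValues_nonneg i

theorem singVal_one_le (A : V →ₗ[ℝ] W) : singVal A 1 ≤ singVal A 0 := by
  have := finiteDimensional_of_plane V
  have := finiteDimensional_of_plane W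
  exact A.singularValues_antitone (by simp)

/-- The squares of both sides equal `det(AᵀA)`: one as a product of eigenvalues, the other as a Gram
determinant. -/
theorem singVal_mul (A : V →ₗ[ℝ] W) : singVal A 0 * singVal A 1 = |jac o o' A| := by
  have := finiteDimensional_of_plane V
  have := finiteDimensional_of_plane W
  have h2 : finrank ℝ V = 2 := Fact.out
  have hd := A.isSymmetric_adjoint_comp_self.det_eq_prod_eigenvalues h2
  rw [← sq_eq_sq₀ (mul_nonneg (singVal_nonneg _ _) (singVal_nonneg _ _)) (abs_nonneg _), sq_abs,
    mul_pow, jac_eq_areaForm, areaForm_sq_eq]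
  have h0 := A.sq_singularValues_fin h2 0
  have h1 := A.sq_singularValues_fin h2 1
  rw [← LinearMap.det_toMatrix (orthoBasis o).toBasis, Matrix.det_fin_two] at hd
  simp only [LinearMap.toMatrix_apply, OrthonormalBasis.coe_toBasis, LinearMap.comp_apply,
    OrthonormalBasis.coe_toBasis_repr_apply, OrthonormalBasis.repr_apply_apply,
    LinearMap.adjoint_inner_right, Fin.prod_univ_two] at hd
  simp only [singVal]
  simp at h0 h1 hd ⊢
  rw [h0, h1, ← hd, real_inner_comm (A (orthoBasis o 1)) (A (orthoBasis o 0))]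
  ring

theorem jac_le (A : V →ₗ[ℝ] W) : 2 * jac o o' A ≤ frobeniusNorm A ^ 2 := by
  rw [jac_eq_areaForm, frobeniusNorm_sq (orthoBasis o)]
  have := o'.areaForm_le (A (orthoBasis o 0)) (A (orthoBasis o 1))
  nlinarith [sq_nonneg (‖A (orthoBasis o 0)‖ - ‖A (orthoBasis o 1)‖)]

/-- The squared distance to the rotations, as a function of the squared norm and the Jacobian. -/
def sqDist (n j : ℝ) : ℝ := n + 2 - 2 * √(n + 2 * j)

theorem distSO_rpow (A : V →ₗ[ℝ] W) (p : ℝ) :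
    distSO o o' A ^ p = sqDist (frobeniusNorm A ^ 2) (jac o o' A) ^ (p / 2) := by
  have h0 : 0 ≤ sqDist (frobeniusNorm A ^ 2) (jac o o' A) := by
    have h1 := Real.sq_sqrt (frobeniusNorm_sq_add_two_mul_jac_nonneg o o' A)
    have h2 := jac_le o o' A
    rw [sqDist]
    -- With `r² = n + 2j ≤ 2n` one has `n + 2 - 2r ≥ (r - 2)² / 2`.
    nlinarith [sq_nonneg (√(frobeniusNorm A ^ 2 + 2 * jac o o' A) - 2)]
  rw [distSO_eq, ← sqDist, Real.sqrt_eq_rpow, ← Real.rpow_mul h0]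
  ring_nf

/-- The left side is `(σ₁ + σ₂)²`. That the radicand of the distance is identically one on the well
is what reduces the first variation to that of the Jacobian. -/
theorem frobeniusNorm_sq_add_of_mem_wellK {A : V →ₗ[ℝ] W} (hA : A ∈ wellK o o') :
    frobeniusNorm A ^ 2 + 2 * jac o o' A = 1 := by
  have h1 := singVal_mul o o' A
  rw [abs_of_nonneg hA.1] at h1
  rw [← singVal_sq_add, ← h1]
  linear_combination (singVal A 0 + singVal A 1 + 1) * hA.2

/-- Arithmetic–geometric mean for `σ₁ + σ₂ = 1`. It keeps `1 - 2J` away from zero, where powers are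
not smooth. -/
theorem jac_le_of_mem_wellK {A : V →ₗ[ℝ] W} (hA : A ∈ wellK o o') : jac o o' A ≤ 1 / 4 := by
  have h1 := singVal_mul o o' A
  rw [abs_of_nonneg hA.1] at h1
  have h2 := hA.2
  nlinarith [sq_nonneg (singVal A 0 - singVal A 1)]

/-- Sum `1` and product `J` make the singular values the two roots of `s² - s + J`. -/
theorem singVal_eq_of_mem_wellK {A : V →ₗ[ℝ] W} (hA : A ∈ wellK o o') :
    singVal A 0 = (1 + √(1 - 4 * jac o o' A)) / 2 ∧
      singVal A 1 = (1 - √(1 - 4 * jac o o' A)) / 2 := by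
  have h1 := singVal_mul o o' A
  rw [abs_of_nonneg hA.1] at h1
  have h2 := hA.2
  have h3 : √(1 - 4 * jac o o' A) = singVal A 0 - singVal A 1 := by
    rw [← Real.sqrt_sq (sub_nonneg.2 (singVal_one_le A))]
    congr 1
    linear_combination (4 : ℝ) * h1 - (singVal A 0 + singVal A 1 + 1) * h2
  constructor <;> linarith

end PlaneAlgebra

/-! ### Metric, area form and differential in charts -/

section ChartCoordinates

variable {X : Type*} [TopologicalSpace X] [ChartedSpace Plane X] [IsManifold (𝓡 2) ∞ X]
  {Y : Type*} [TopologicalSpace Y] [ChartedSpace Plane Y] [IsManifold (𝓡 2) ∞ Y]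

/-- The tangent map of the inverse of the chart at `x₀`, in the model plane. -/
def chartFrame (x₀ : X) (u : Plane) : Plane →L[ℝ] Plane :=
  mfderiv (𝓡 2) (𝓡 2) (chartAt Plane x₀).symm u

/-- The tangent map of `φ`, in the model plane. -/
def planeDiff (φ : X → Y) (x : X) : Plane →L[ℝ] Plane := mfderiv (𝓡 2) (𝓡 2) φ x

/-- The expression of `φ` in the charts at `x₀` and `y₀`. -/
def inCharts (x₀ : X) (y₀ : Y) (φ : X → Y) (u : Plane) : Plane :=
  chartAt Plane y₀ (φ ((chartAt Plane x₀).symm u))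

theorem eventually_chart_target {x₀ : X} {u : Plane} (hu : u ∈ (chartAt Plane x₀).target) :
    ∀ᶠ v in 𝓝 u, v ∈ (chartAt Plane x₀).target :=
  (chartAt Plane x₀).open_target.mem_nhds hu

theorem mdifferentiableAt_chart_symm {x₀ : X} {u : Plane} (hu : u ∈ (chartAt Plane x₀).target) :
    MDifferentiableAt (𝓡 2) (𝓡 2) (chartAt Plane x₀).symm u :=
  mdifferentiableAt_atlas_symm (chart_mem_atlas Plane x₀) hu

theorem mdifferentiableAt_chart {x₀ x : X} (hx : x ∈ (chartAt Plane x₀).source) :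
    MDifferentiableAt (𝓡 2) (𝓡 2) (chartAt Plane x₀) x :=
  mdifferentiableAt_atlas (chart_mem_atlas Plane x₀) hx

theorem differentiableAt_inCharts {φ : X → Y} {x₀ : X} {y₀ : Y} {u : Plane}
    (hu : u ∈ (chartAt Plane x₀).target)
    (hφ : MDifferentiableAt (𝓡 2) (𝓡 2) φ ((chartAt Plane x₀).symm u))
    (hy : φ ((chartAt Plane x₀).symm u) ∈ (chartAt Plane y₀).source) :
    DifferentiableAt ℝ (inCharts x₀ y₀ φ) u := by
  rw [← mdifferentiableAt_iff_differentiableAt]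
  exact (mdifferentiableAt_chart hy).comp u (hφ.comp u (mdifferentiableAt_chart_symm hu))

/-- The tangent map of `φ` maps coordinate frames by the derivative of the coordinate
expression. -/
theorem planeDiff_chartFrame {φ : X → Y} {x₀ : X} {y₀ : Y} {u : Plane}
    (hu : u ∈ (chartAt Plane x₀).target)
    (hφ : MDifferentiableAt (𝓡 2) (𝓡 2) φ ((chartAt Plane x₀).symm u))
    (hy : φ ((chartAt Plane x₀).symm u) ∈ (chartAt Plane y₀).source) (v : Plane) :
    planeDiff φ ((chartAt Plane x₀).symm u) (chartFrame x₀ u v) =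
      chartFrame y₀ (inCharts x₀ y₀ φ u) (fderiv ℝ (inCharts x₀ y₀ φ) u v) := by
  have hd := differentiableAt_inCharts hu hφ hy
  have hs := mdifferentiableAt_chart_symm hu
  have htgt : inCharts x₀ y₀ φ u ∈ (chartAt Plane y₀).target := (chartAt Plane y₀).map_source hy
  have hev : φ ∘ (chartAt Plane x₀).symm =ᶠ[𝓝 u]
      (chartAt Plane y₀).symm ∘ inCharts x₀ y₀ φ := by
    have hc : ContinuousAt (φ ∘ (chartAt Plane x₀).symm) u := (hφ.comp u hs).continuousAt
    filter_upwards [hc.preimage_mem_nhds ((chartAt Plane y₀).open_source.mem_nhds hy)] with z hz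
    exact ((chartAt Plane y₀).left_inv hz).symm
  have h1 := mfderiv_comp u hφ hs
  have h2 := mfderiv_comp u (mdifferentiableAt_chart_symm htgt) hd.mdifferentiableAt
  have h3 := hev.mfderiv_eq (I := 𝓡 2) (I' := 𝓡 2)
  rw [mfderiv_eq_fderiv] at h2
  have h4 := (h1.symm.trans h3).trans h2
  -- All tangent spaces are definitionally the model plane, so the two chain rules can be compared
  -- as maps of that plane.
  exact congrArg (fun L : Plane →L[ℝ] Plane => L v) h4

/-- The tangent map of the smooth inverse chart is applied to a constant section. The total-space
form is the one that smoothness of the metric takes as input. -/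
theorem contMDiffOn_chartFrame (x₀ : X) (v : Plane) :
    ContMDiffOn (𝓡 2) ((𝓡 2).prod 𝓘(ℝ, Plane)) ∞
      (fun u : Plane => (⟨(chartAt Plane x₀).symm u, chartFrame x₀ u v⟩ : TangentBundle (𝓡 2) X))
      (chartAt Plane x₀).target := by
  have h := (contMDiffOn_chart_symm (I := 𝓡 2) (n := ∞) (x := x₀) (H := Plane)).contMDiffOn_tangentMapWithin
    (m := ∞) (by simp) (chartAt Plane x₀).open_target.uniqueMDiffOn
  have h2 : ContMDiff (𝓡 2) ((𝓡 2).prod 𝓘(ℝ, Plane)) ∞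
      (fun u : Plane => (⟨u, v⟩ : TangentBundle (𝓡 2) Plane)) := by
    intro u
    rw [Bundle.contMDiffAt_totalSpace]
    refine ⟨contMDiffAt_id, ?_⟩
    simp
    exact contMDiffAt_const
  have h3 := h.comp h2.contMDiffOn (s := (chartAt Plane x₀).target) (fun u hu => hu)
  refine h3.congr fun u hu => ?_
  simp only [Function.comp_apply, tangentMapWithin,
    mfderivWithin_of_isOpen (chartAt Plane x₀).open_target hu]
  rfl

variable [Bundle.RiemannianBundle (fun x : X => TangentSpace (𝓡 2) x)]
  [Bundle.RiemannianBundle (fun y : Y => TangentSpace (𝓡 2) y)]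

/-- The Riemannian metric on vectors of the model plane. -/
def tangentInner (x : X) (v w : Plane) : ℝ := @inner ℝ (TangentSpace (𝓡 2) x) _ v w

/-- The oriented area form on vectors of the model plane. -/
def tangentArea (oX : SurfaceOrientation X) (x : X) (v w : Plane) : ℝ :=
  (oX.at_point x).areaForm (v : TangentSpace (𝓡 2) x) w

/-- The metric in the chart at `x₀`. -/
def chartInner (x₀ : X) (u v w : Plane) : ℝ :=
  tangentInner ((chartAt Plane x₀).symm u) (chartFrame x₀ u v) (chartFrame x₀ u w)

/-- The standard basis of the model plane. -/
abbrev stdVec (i : Fin 2) : Plane := EuclideanSpace.single i 1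

/-- The component of the area form in the chart at `x₀`. -/
def chartArea (oX : SurfaceOrientation X) (x₀ : X) (u : Plane) : ℝ :=
  tangentArea oX ((chartAt Plane x₀).symm u) (chartFrame x₀ u (stdVec 0)) (chartFrame x₀ u (stdVec 1))

/-- The determinant of two vectors of the model plane. -/
def det2 (v w : Plane) : ℝ := v 0 * w 1 - v 1 * w 0

theorem eq_smul_stdVec (v : Plane) : v = v 0 • stdVec 0 + v 1 • stdVec 1 := by
  ext i; fin_cases i <;> simp

theorem tangentArea_map (oX : SurfaceOrientation X) (x : X) (L : Plane →L[ℝ] Plane) (v w : Plane) :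
    tangentArea oX x (L v) (L w) = det2 v w * tangentArea oX x (L (stdVec 0)) (L (stdVec 1)) := by
  have h2 := (oX.at_point x).areaForm_swap (L (stdVec 1)) (L (stdVec 0))
  have hv : L v = v 0 • L (stdVec 0) + v 1 • L (stdVec 1) := by
    conv_lhs => rw [eq_smul_stdVec v]
    simp only [map_add, map_smul]
  have hw : L w = w 0 • L (stdVec 0) + w 1 • L (stdVec 1) := by
    conv_lhs => rw [eq_smul_stdVec w]
    simp only [map_add, map_smul]
  have e : ∀ (a b c d : ℝ) (p q : TangentSpace (𝓡 2) x),
      (oX.at_point x).areaForm (a • p + b • q) (c • p + d • q) =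
        (a * d - b * c) * (oX.at_point x).areaForm p q := by
    intro a b c d p q
    have h2 := (oX.at_point x).areaForm_swap q p
    simp only [map_add, map_smul, LinearMap.add_apply, LinearMap.smul_apply, smul_eq_mul,
      Orientation.areaForm_apply_self, h2]
    ring
  rw [hv, hw]
  exact e _ _ _ _ _ _

theorem chartArea_mul_det2 (oX : SurfaceOrientation X) (x₀ : X) (u v w : Plane) :
    tangentArea oX ((chartAt Plane x₀).symm u) (chartFrame x₀ u v) (chartFrame x₀ u w) =
      det2 v w * chartArea oX x₀ u :=
  tangentArea_map oX _ _ _ _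

theorem chartInner_expand (x₀ : X) (u v w : Plane) : chartInner x₀ u v w =
    v 0 * w 0 * chartInner x₀ u (stdVec 0) (stdVec 0) +
    (v 0 * w 1 + v 1 * w 0) * chartInner x₀ u (stdVec 0) (stdVec 1) +
    v 1 * w 1 * chartInner x₀ u (stdVec 1) (stdVec 1) := by
  -- Vectors are typed in the tangent space here, so that `inner` is the Riemannian metric and not
  -- the Euclidean product of the model plane.
  have e : ∀ (a b c d : ℝ) (p q : TangentSpace (𝓡 2) ((chartAt Plane x₀).symm u)),
      inner ℝ (a • p + b • q) (c • p + d • q) =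
        a * c * inner ℝ p p + (a * d + b * c) * inner ℝ p q + b * d * inner ℝ q q := by
    intro a b c d p q
    simp only [inner_add_left, inner_add_right, real_inner_smul_left, real_inner_smul_right,
      real_inner_comm p q]
    ring
  have hv : ∀ v, chartFrame x₀ u v =
      v 0 • chartFrame x₀ u (stdVec 0) + v 1 • chartFrame x₀ u (stdVec 1) := fun v => by
    conv_lhs => rw [eq_smul_stdVec v]
    simp only [map_add, map_smul]
  rw [chartInner, hv v, hv w]
  exact e _ _ _ _ _ _

theorem chartArea_sq (oX : SurfaceOrientation X) (x₀ : X) (u : Plane) :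
    chartArea oX x₀ u ^ 2 = (Matrix.gram ℝ (coordFrame x₀ u)).det := by
  rw [Matrix.det_fin_two]
  have h := areaForm_sq_eq (oX.at_point ((chartAt Plane x₀).symm u)) (coordFrame x₀ u 0)
    (coordFrame x₀ u 1)
  simp only [Matrix.gram_apply, real_inner_self_eq_norm_sq]
  rw [real_inner_comm (coordFrame x₀ u 0) (coordFrame x₀ u 1), ← pow_two (inner ℝ _ _)]
  exact h

theorem contDiffOn_chartInner [IsContMDiffRiemannianBundle (𝓡 2) ∞ Plane
      (fun x : X => TangentSpace (𝓡 2) x)] (x₀ : X) (v w : Plane) :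
    ContDiffOn ℝ ∞ (fun u => chartInner x₀ u v w) (chartAt Plane x₀).target := by
  rw [← contMDiffOn_iff_contDiffOn]
  exact (contMDiffOn_chartFrame x₀ v).inner_bundle (contMDiffOn_chartFrame x₀ w)

theorem chartFrame_injective {x₀ : X} {u : Plane} (hu : u ∈ (chartAt Plane x₀).target) :
    Function.Injective (chartFrame x₀ u) := by
  have h := (mdifferentiable_chart (I := 𝓡 2) x₀).symm.mfderiv_injective (x := u) hu
  exact h

/-- The coordinate frame spans, so otherwise the area form would vanish identically, whereas it is
`1` on an oriented orthonormal basis. -/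
theorem chartArea_ne_zero (oX : SurfaceOrientation X) {x₀ : X} {u : Plane}
    (hu : u ∈ (chartAt Plane x₀).target) : chartArea oX x₀ u ≠ 0 := by
  intro h0
  have hs : Function.Surjective (chartFrame x₀ u) :=
    LinearMap.injective_iff_surjective (f := (chartFrame x₀ u).toLinearMap).1
      (chartFrame_injective hu)
  have hz : ∀ v w : Plane, tangentArea oX ((chartAt Plane x₀).symm u) v w = 0 := by
    intro v w
    obtain ⟨v, rfl⟩ := hs v
    obtain ⟨w, rfl⟩ := hs w
    rw [chartArea_mul_det2, h0, mul_zero]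
  have h1 := areaForm_orthoBasis (oX.at_point ((chartAt Plane x₀).symm u))
  exact zero_ne_one ((hz _ _).symm.trans h1)

theorem continuousOn_chartArea (oX : SurfaceOrientation X) (x₀ : X) :
    ContinuousOn (chartArea oX x₀) (chartAt Plane x₀).target := by
  refine (oX.continuousOn_volumeForm x₀).congr fun u hu => ?_
  have h := (oX.at_point ((chartAt Plane x₀).symm u)).areaForm_to_volumeForm
    (coordFrame x₀ u 0) (coordFrame x₀ u 1)
  have h2 : ![coordFrame x₀ u 0, coordFrame x₀ u 1] = coordFrame x₀ u := by
    ext i; fin_cases i <;> rfl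
  rw [h2] at h
  exact h

theorem chartArea_sq_eq_chartInner (oX : SurfaceOrientation X) (x₀ : X) (u : Plane) :
    chartArea oX x₀ u ^ 2 = chartInner x₀ u (stdVec 0) (stdVec 0) *
      chartInner x₀ u (stdVec 1) (stdVec 1) - chartInner x₀ u (stdVec 0) (stdVec 1) ^ 2 := by
  have h := areaForm_sq_eq (oX.at_point ((chartAt Plane x₀).symm u)) (coordFrame x₀ u 0)
    (coordFrame x₀ u 1)
  rw [← real_inner_self_eq_norm_sq, ← real_inner_self_eq_norm_sq] at h
  exact h

/-- Near each point of a chart the component of the area form has a constant sign. -/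
theorem eventually_chartArea_eq (oX : SurfaceOrientation X) {x₀ : X} {u : Plane}
    (hu : u ∈ (chartAt Plane x₀).target) : ∃ s : ℝ, (s = 1 ∨ s = -1) ∧
      ∀ᶠ v in 𝓝 u, chartArea oX x₀ v = s * √(chartArea oX x₀ v ^ 2) := by
  have hc := (continuousOn_chartArea oX x₀).continuousAt (eventually_chart_target hu)
  rcases lt_or_gt_of_ne (chartArea_ne_zero oX hu) with h | h
  · refine ⟨-1, Or.inr rfl, ?_⟩
    filter_upwards [hc.eventually_lt_const h] with v hv
    rw [Real.sqrt_sq_eq_abs, abs_of_neg hv]; ring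
  · refine ⟨1, Or.inl rfl, ?_⟩
    filter_upwards [hc.eventually_const_lt h] with v hv
    rw [Real.sqrt_sq_eq_abs, abs_of_pos hv]; ring

/-- An orientation is only required to be continuous. Smoothness comes from the metric: locally the
component is a fixed sign times the root of the nonvanishing Gram determinant. -/
theorem contDiffAt_chartArea [IsContMDiffRiemannianBundle (𝓡 2) ∞ Plane
      (fun x : X => TangentSpace (𝓡 2) x)] (oX : SurfaceOrientation X) {x₀ : X} {u : Plane}
    (hu : u ∈ (chartAt Plane x₀).target) : ContDiffAt ℝ ∞ (chartArea oX x₀) u := by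
  obtain ⟨s, -, hs⟩ := eventually_chartArea_eq oX hu
  have hI : ∀ v w, ContDiffAt ℝ ∞ (fun u => chartInner x₀ u v w) u := fun v w =>
    (contDiffOn_chartInner x₀ v w).contDiffAt (eventually_chart_target hu)
  refine ContDiffAt.congr_of_eventuallyEq ?_ hs
  refine contDiffAt_const.mul (ContDiffAt.sqrt ?_ (pow_ne_zero 2 (chartArea_ne_zero oX hu)))
  simp only [chartArea_sq_eq_chartInner]
  exact ((hI _ _).mul (hI _ _)).sub ((hI _ _).pow 2)

/-- The Jacobian in coordinates. -/
theorem jac_mul_chartArea (oX : SurfaceOrientation X) (oY : SurfaceOrientation Y)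
    {φ : X → Y} {x₀ : X} {y₀ : Y} {u : Plane}
    (hu : u ∈ (chartAt Plane x₀).target)
    (hφ : MDifferentiableAt (𝓡 2) (𝓡 2) φ ((chartAt Plane x₀).symm u))
    (hy : φ ((chartAt Plane x₀).symm u) ∈ (chartAt Plane y₀).source) :
    jac (oX.at_point ((chartAt Plane x₀).symm u)) (oY.at_point (φ ((chartAt Plane x₀).symm u)))
        (diff φ ((chartAt Plane x₀).symm u)) * chartArea oX x₀ u =
      det2 (fderiv ℝ (inCharts x₀ y₀ φ) u (stdVec 0)) (fderiv ℝ (inCharts x₀ y₀ φ) u (stdVec 1)) *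
        chartArea oY y₀ (inCharts x₀ y₀ φ u) := by
  have h1 : ∀ v w : Plane, jac (oX.at_point ((chartAt Plane x₀).symm u))
      (oY.at_point (φ ((chartAt Plane x₀).symm u))) (diff φ ((chartAt Plane x₀).symm u)) *
        tangentArea oX ((chartAt Plane x₀).symm u) v w =
      tangentArea oY (φ ((chartAt Plane x₀).symm u))
        (planeDiff φ ((chartAt Plane x₀).symm u) v) (planeDiff φ ((chartAt Plane x₀).symm u) w) :=
    fun v w => jac_mul_areaForm _ _ _ _ _
  rw [chartArea, h1, planeDiff_chartFrame hu hφ hy, planeDiff_chartFrame hu hφ hy,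
    ← chartArea_mul_det2]
  congr 1
  exact ((chartAt Plane y₀).left_inv hy).symm

/-- The norm of the differential in coordinates. -/
theorem frobeniusNorm_sq_mul_chartArea_sq (oX : SurfaceOrientation X) {φ : X → Y} {x₀ : X}
    {y₀ : Y} {u : Plane} (hu : u ∈ (chartAt Plane x₀).target)
    (hφ : MDifferentiableAt (𝓡 2) (𝓡 2) φ ((chartAt Plane x₀).symm u))
    (hy : φ ((chartAt Plane x₀).symm u) ∈ (chartAt Plane y₀).source) :
    frobeniusNorm (diff φ ((chartAt Plane x₀).symm u)) ^ 2 * chartArea oX x₀ u ^ 2 =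
      chartInner x₀ u (stdVec 1) (stdVec 1) *
        chartInner y₀ (inCharts x₀ y₀ φ u) (fderiv ℝ (inCharts x₀ y₀ φ) u (stdVec 0))
          (fderiv ℝ (inCharts x₀ y₀ φ) u (stdVec 0)) -
      2 * chartInner x₀ u (stdVec 0) (stdVec 1) *
        chartInner y₀ (inCharts x₀ y₀ φ u) (fderiv ℝ (inCharts x₀ y₀ φ) u (stdVec 0))
          (fderiv ℝ (inCharts x₀ y₀ φ) u (stdVec 1)) +
      chartInner x₀ u (stdVec 0) (stdVec 0) *
        chartInner y₀ (inCharts x₀ y₀ φ u) (fderiv ℝ (inCharts x₀ y₀ φ) u (stdVec 1))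
          (fderiv ℝ (inCharts x₀ y₀ φ) u (stdVec 1)) := by
  have e : ∀ (x : X) (v w : Plane), frobeniusNorm (diff φ x) ^ 2 * tangentArea oX x v w ^ 2 =
      tangentInner x w w * tangentInner (φ x) (planeDiff φ x v) (planeDiff φ x v) -
      2 * tangentInner x v w * tangentInner (φ x) (planeDiff φ x v) (planeDiff φ x w) +
      tangentInner x v v * tangentInner (φ x) (planeDiff φ x w) (planeDiff φ x w) := by
    intro x v w
    exact frobeniusNorm_sq_mul_areaForm_sq (oX.at_point x) (diff φ x) v w
  rw [chartArea, e, planeDiff_chartFrame hu hφ hy, planeDiff_chartFrame hu hφ hy]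
  simp only [chartInner]
  have hl : (chartAt Plane y₀).symm (inCharts x₀ y₀ φ u) = φ ((chartAt Plane x₀).symm u) :=
    (chartAt Plane y₀).left_inv hy
  rw [hl]

end ChartCoordinates

/-! ### The Riemannian area measure in charts -/

theorem det_eq_det2 (L : Plane →L[ℝ] Plane) : L.det = det2 (L (stdVec 0)) (L (stdVec 1)) := by
  rw [ContinuousLinearMap.det, ← LinearMap.det_toMatrix (EuclideanSpace.basisFun (Fin 2) ℝ).toBasis,
    Matrix.det_fin_two]
  simp [LinearMap.toMatrix_apply, det2]
  ring

section Volume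

variable {X : Type*} [TopologicalSpace X] [ChartedSpace Plane X] [IsManifold (𝓡 2) ∞ X]
  [Bundle.RiemannianBundle (fun x : X => TangentSpace (𝓡 2) x)]

/-- Change of charts for the area form. -/
theorem chartArea_changeOfCharts (oX : SurfaceOrientation X) {x₀ x₁ : X} {u : Plane}
    (hu : u ∈ (chartAt Plane x₀).target)
    (hu' : (chartAt Plane x₀).symm u ∈ (chartAt Plane x₁).source) :
    chartArea oX x₀ u = (fderiv ℝ (inCharts x₀ x₁ (id : X → X)) u).det *
      chartArea oX x₁ (inCharts x₀ x₁ (id : X → X) u) := by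
  have hid : MDifferentiableAt (𝓡 2) (𝓡 2) (id : X → X) ((chartAt Plane x₀).symm u) :=
    mdifferentiableAt_id
  have h := fun v => planeDiff_chartFrame hu hid (y₀ := x₁) hu' v
  have hpl : ∀ x v, planeDiff (id : X → X) x v = v := by
    intro x v
    rw [planeDiff, mfderiv_id]
    rfl
  simp only [hpl] at h
  rw [det_eq_det2, ← chartArea_mul_det2, chartArea, h, h]
  congr 1
  exact ((chartAt Plane x₁).left_inv hu').symm

theorem sqrt_det_gram (oX : SurfaceOrientation X) (x₀ : X) (u : Plane) :
    √(Matrix.gram ℝ (coordFrame x₀ u)).det = |chartArea oX x₀ u| := by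
  rw [← chartArea_sq oX, Real.sqrt_sq_eq_abs]

variable [MeasurableSpace X] [BorelSpace X]

theorem measurableSet_chart_preimage (x₀ : X) {S : Set X} (hS : MeasurableSet S) :
    MeasurableSet ((chartAt Plane x₀).symm ⁻¹' S ∩ (chartAt Plane x₀).target) := by
  have h := ((chartAt Plane x₀).symm.continuousOn.domRestrict).measurable hS
  have h2 := (chartAt Plane x₀).open_target.measurableSet.subtype_image h
  convert h2 using 1
  ext u
  simp [and_comm]

theorem aemeasurable_chart_symm (x₀ : X) :
    AEMeasurable (chartAt Plane x₀).symm (volume.restrict (chartAt Plane x₀).target) :=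
  (chartAt Plane x₀).symm.continuousOn.aemeasurable (chartAt Plane x₀).open_target.measurableSet

theorem chartVolume_apply (oX : SurfaceOrientation X) (x₀ : X) {S : Set X} (hS : MeasurableSet S) :
    chartVolume x₀ S = ∫⁻ u in (chartAt Plane x₀).symm ⁻¹' S ∩ (chartAt Plane x₀).target,
      ENNReal.ofReal |chartArea oX x₀ u| := by
  rw [chartVolume, Measure.map_apply_of_aemeasurable
    ((aemeasurable_chart_symm x₀).mono_ac (withDensity_absolutelyContinuous _ _)) hS,
    withDensity_apply', Measure.restrict_restrict' (chartAt Plane x₀).open_target.measurableSet]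
  simp only [sqrt_det_gram oX]

theorem chartVolume_inter_source (oX : SurfaceOrientation X) (x₀ : X) {S : Set X}
    (hS : MeasurableSet S) : chartVolume x₀ (S ∩ (chartAt Plane x₀).source) = chartVolume x₀ S := by
  rw [chartVolume_apply oX x₀ hS,
    chartVolume_apply oX x₀ (hS.inter (chartAt Plane x₀).open_source.measurableSet)]
  congr 2
  ext u
  simp only [mem_inter_iff, mem_preimage]
  exact ⟨fun h => ⟨h.1.1, h.2⟩, fun h => ⟨⟨h.1, (chartAt Plane x₀).map_target h.2⟩, h.2⟩⟩

/-- Change of variables along the transition map `τ`, whose Jacobian is exactly the ratio of the two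
area components. -/
theorem chartVolume_eq_of_subset (oX : SurfaceOrientation X) {x₀ x₁ : X} {S : Set X}
    (hS : MeasurableSet S) (h0 : S ⊆ (chartAt Plane x₀).source)
    (h1 : S ⊆ (chartAt Plane x₁).source) : chartVolume x₀ S = chartVolume x₁ S := by
  rw [chartVolume_apply oX x₀ hS, chartVolume_apply oX x₁ hS]
  set A := (chartAt Plane x₀).symm ⁻¹' S ∩ (chartAt Plane x₀).target with hA
  set τ := inCharts x₀ x₁ (id : X → X) with hτ
  have himg : (chartAt Plane x₁).symm ⁻¹' S ∩ (chartAt Plane x₁).target = τ '' A := by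
    ext v
    constructor
    · rintro ⟨hv, hvt⟩
      refine ⟨chartAt Plane x₀ ((chartAt Plane x₁).symm v), ⟨?_, ?_⟩, ?_⟩
      · simpa [(chartAt Plane x₀).left_inv (h0 hv)] using hv
      · exact (chartAt Plane x₀).map_source (h0 hv)
      · simp [hτ, inCharts, (chartAt Plane x₀).left_inv (h0 hv), (chartAt Plane x₁).right_inv hvt]
    · rintro ⟨u, ⟨hu, hut⟩, rfl⟩
      refine ⟨?_, (chartAt Plane x₁).map_source (h1 hu)⟩
      simpa [hτ, inCharts, (chartAt Plane x₁).left_inv (h1 hu)] using hu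
  have hinj : InjOn τ A := by
    rintro u ⟨hu, hut⟩ v ⟨hv, hvt⟩ huv
    exact (chartAt Plane x₀).symm.injOn hut hvt ((chartAt Plane x₁).injOn (h1 hu) (h1 hv) huv)
  have hder : ∀ u ∈ A, HasFDerivWithinAt τ (fderiv ℝ τ u) A u := by
    rintro u ⟨hu, hut⟩
    exact (differentiableAt_inCharts hut mdifferentiableAt_id (h1 hu)).hasFDerivAt.hasFDerivWithinAt
  rw [himg, lintegral_image_eq_lintegral_abs_det_fderiv_mul volume
    (measurableSet_chart_preimage x₀ hS) hder hinj]
  refine setLIntegral_congr_fun (measurableSet_chart_preimage x₀ hS) ?_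
  rintro u ⟨hu, hut⟩
  simp only
  rw [chartArea_changeOfCharts oX hut (h1 hu), abs_mul, ENNReal.ofReal_mul (abs_nonneg _)]

/-- A supremum of measures is not computed set by set. It is bounded above by one measure, glued
from countably many chart measures along disjointed domains, which agrees with the measure of any
chart on its domain. -/
theorem riemannianVolume_apply_of_subset [SecondCountableTopology X] (oX : SurfaceOrientation X)
    {x₀ : X} {S : Set X} (hS : MeasurableSet S) (h0 : S ⊆ (chartAt Plane x₀).source) :
    riemannianVolume X S = chartVolume x₀ S := by
  refine le_antisymm ?_ (Measure.le_iff'.1 (le_iSup chartVolume x₀) S)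
  obtain ⟨s, hsc, hs⟩ := TopologicalSpace.countable_cover_nhds
    (f := fun x : X => (chartAt Plane x).source)
    (fun x => (chartAt Plane x).open_source.mem_nhds (mem_chart_source Plane x))
  have hne : s.Nonempty := by
    have hx : x₀ ∈ ⋃ x ∈ s, (chartAt Plane x).source := hs ▸ mem_univ x₀
    simp only [mem_iUnion] at hx
    obtain ⟨x, hx, -⟩ := hx
    exact ⟨x, hx⟩
  obtain ⟨c, rfl⟩ := hsc.exists_eq_range hne
  rw [biUnion_range] at hs
  set D := disjointed fun n => (chartAt Plane (c n)).source with hD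
  have hDm : ∀ n, MeasurableSet (D n) := fun n =>
    MeasurableSet.disjointed (fun n => (chartAt Plane (c n)).open_source.measurableSet) n
  have hDs : ∀ n, D n ⊆ (chartAt Plane (c n)).source := fun n => disjointed_subset _ n
  have hDu : ⋃ n, D n = univ := by rw [hD, iUnion_disjointed, hs]
  have hdisj : Pairwise (Function.onFun Disjoint D) := disjoint_disjointed _
  have hsum : ∀ (μ : Measure X) (T : Set X), MeasurableSet T → μ T = ∑' n, μ (T ∩ D n) := by
    intro μ T hT
    rw [← measure_iUnion (fun i j hij => (hdisj hij).mono inter_subset_right inter_subset_right)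
      (fun n => hT.inter (hDm n)), ← inter_iUnion, hDu, inter_univ]
  -- It suffices to dominate each chart measure; on every piece `D n` it agrees with that of `c n`
  -- where both charts are defined.
  have hle : riemannianVolume X ≤ Measure.sum fun n => (chartVolume (c n)).restrict (D n) := by
    refine iSup_le fun x => Measure.le_iff.2 fun T hT => ?_
    rw [hsum _ T hT, Measure.sum_apply _ hT]
    refine ENNReal.tsum_le_tsum fun n => ?_
    rw [Measure.restrict_apply hT, ← chartVolume_inter_source oX x (hT.inter (hDm n)),
      chartVolume_eq_of_subset oX (x₁ := c n)
        ((hT.inter (hDm n)).inter (chartAt Plane x).open_source.measurableSet)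
        inter_subset_right (fun z hz => hDs n hz.1.2)]
    exact measure_mono inter_subset_left
  refine (Measure.le_iff'.1 hle S).trans (le_of_eq ?_)
  rw [Measure.sum_apply _ hS, hsum _ S hS]
  refine tsum_congr fun n => ?_
  rw [Measure.restrict_apply hS]
  exact chartVolume_eq_of_subset oX (hS.inter (hDm n)) (fun z hz => hDs n hz.2)
    (fun z hz => h0 hz.1)

theorem riemannianVolume_restrict_source [SecondCountableTopology X] (oX : SurfaceOrientation X)
    (x₀ : X) : (riemannianVolume X).restrict (chartAt Plane x₀).source = chartVolume x₀ := by
  ext S hS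
  rw [Measure.restrict_apply hS, riemannianVolume_apply_of_subset oX
    (hS.inter (chartAt Plane x₀).open_source.measurableSet) inter_subset_right,
    chartVolume_inter_source oX x₀ hS]

/-- Integration in a chart. -/
theorem setIntegral_source [SecondCountableTopology X] (oX : SurfaceOrientation X) (x₀ : X)
    (f : X → ℝ) (hfm : AEStronglyMeasurable f
      ((riemannianVolume X).restrict (chartAt Plane x₀).source)) :
    ∫ x in (chartAt Plane x₀).source, f x ∂(riemannianVolume X) =
      ∫ u in (chartAt Plane x₀).target, |chartArea oX x₀ u| * f ((chartAt Plane x₀).symm u) := by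
  have hρ : AEMeasurable (fun u => ENNReal.ofReal √(Matrix.gram ℝ (coordFrame x₀ u)).det)
      (volume.restrict (chartAt Plane x₀).target) := by
    simp only [sqrt_det_gram oX]
    exact (((continuousOn_chartArea oX x₀).abs).aemeasurable
      (chartAt Plane x₀).open_target.measurableSet).ennreal_ofReal
  rw [riemannianVolume_restrict_source oX] at hfm ⊢
  rw [chartVolume] at hfm ⊢
  rw [integral_map ((aemeasurable_chart_symm x₀).mono_ac (withDensity_absolutelyContinuous _ _))
    hfm, integral_withDensity_eq_integral_toReal_smul₀ hρ (by simp)]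
  simp [sqrt_det_gram oX]

theorem setIntegral_of_subset_source [SecondCountableTopology X] (oX : SurfaceOrientation X)
    {x₀ : X} {U : Set X} (hU : IsOpen U) (hUs : U ⊆ (chartAt Plane x₀).source)
    {f : X → ℝ} (hf : ContinuousOn f U) :
    ∫ x in U, f x ∂(riemannianVolume X) =
      ∫ u in (chartAt Plane x₀).target ∩ (chartAt Plane x₀).symm ⁻¹' U,
        |chartArea oX x₀ u| * f ((chartAt Plane x₀).symm u) := by
  have hA : IsOpen ((chartAt Plane x₀).target ∩ (chartAt Plane x₀).symm ⁻¹' U) :=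
    (chartAt Plane x₀).isOpen_inter_preimage_symm hU
  have h1 : ∫ x in U, f x ∂(riemannianVolume X) =
      ∫ x in (chartAt Plane x₀).source, U.indicator f x ∂(riemannianVolume X) := by
    rw [setIntegral_indicator hU.measurableSet, inter_eq_self_of_subset_right hUs]
  have h2 : ∀ u, |chartArea oX x₀ u| * U.indicator f ((chartAt Plane x₀).symm u) =
      ((chartAt Plane x₀).symm ⁻¹' U).indicator
        (fun u => |chartArea oX x₀ u| * f ((chartAt Plane x₀).symm u)) u := by
    intro u
    by_cases hu : (chartAt Plane x₀).symm u ∈ U <;> simp [hu]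
  rw [h1, setIntegral_source oX]
  · rw [← integral_indicator (chartAt Plane x₀).open_target.measurableSet,
      ← integral_indicator hA.measurableSet]
    simp only [h2]
    rw [← indicator_indicator]
  · rw [aestronglyMeasurable_indicator_iff hU.measurableSet, Measure.restrict_restrict
      hU.measurableSet, inter_eq_self_of_subset_left hUs]
    exact hf.aestronglyMeasurable hU.measurableSet

theorem riemannianVolume_lt_top [SecondCountableTopology X] (oX : SurfaceOrientation X)
    {C : Set X} (hC : IsCompact C) : riemannianVolume X C < ⊤ := by
  refine hC.measure_lt_top_of_nhdsWithin fun x _ => Measure.FiniteAtFilter.filter_mono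
    nhdsWithin_le_nhds ?_
  obtain ⟨r, hr, hrt⟩ := Metric.nhds_basis_closedBall.mem_iff.1
    ((chartAt Plane x).open_target.mem_nhds (mem_chart_target Plane x))
  set U := (chartAt Plane x).source ∩ chartAt Plane x ⁻¹' Metric.ball (chartAt Plane x x) r with hU
  have hUo : IsOpen U := (chartAt Plane x).isOpen_inter_preimage Metric.isOpen_ball
  refine ⟨U, hUo.mem_nhds ⟨mem_chart_source Plane x, by simp [hr]⟩, ?_⟩
  rw [riemannianVolume_apply_of_subset oX hUo.measurableSet inter_subset_left,
    chartVolume_apply oX x hUo.measurableSet]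
  have hsub : (chartAt Plane x).symm ⁻¹' U ∩ (chartAt Plane x).target ⊆
      Metric.closedBall (chartAt Plane x x) r := by
    rintro u ⟨⟨-, hu⟩, hut⟩
    rw [mem_preimage, (chartAt Plane x).right_inv hut] at hu
    exact Metric.ball_subset_closedBall hu
  refine (lintegral_mono_set hsub).trans_lt ?_
  have hi : IntegrableOn (chartArea oX x) (Metric.closedBall (chartAt Plane x x) r) :=
    ((continuousOn_chartArea oX x).mono hrt).integrableOn_compact (isCompact_closedBall _ _)
  have h2 := hi.2
  simpa only [HasFiniteIntegral, Real.enorm_eq_ofReal_abs] using h2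

/-- The chart density vanishes nowhere. With finiteness on compact sets this allows the factor `1 /
Vol(M)` to be cancelled. -/
theorem riemannianVolume_pos [SecondCountableTopology X] (oX : SurfaceOrientation X)
    {U : Set X} (hU : IsOpen U) (hne : U.Nonempty) : 0 < riemannianVolume X U := by
  obtain ⟨x, hx⟩ := hne
  have hSo : IsOpen (U ∩ (chartAt Plane x).source) := hU.inter (chartAt Plane x).open_source
  refine lt_of_lt_of_le ?_ (measure_mono (inter_subset_left : U ∩ (chartAt Plane x).source ⊆ U))
  rw [riemannianVolume_apply_of_subset oX hSo.measurableSet inter_subset_right,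
    chartVolume_apply oX x hSo.measurableSet, inter_comm, pos_iff_ne_zero]
  have hA : IsOpen ((chartAt Plane x).target ∩
      (chartAt Plane x).symm ⁻¹' (U ∩ (chartAt Plane x).source)) :=
    (chartAt Plane x).isOpen_inter_preimage_symm hSo
  intro h0
  rw [lintegral_eq_zero_iff' ((((continuousOn_chartArea oX x).mono inter_subset_left).abs
    ).aemeasurable hA.measurableSet).ennreal_ofReal, Filter.EventuallyEq,
    ae_restrict_iff' hA.measurableSet] at h0
  have h1 : volume ((chartAt Plane x).target ∩
      (chartAt Plane x).symm ⁻¹' (U ∩ (chartAt Plane x).source)) = 0 := by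
    refine measure_mono_null (fun u hu => ?_) (ae_iff.1 h0)
    simp [chartArea_ne_zero oX hu.1, hu.1, hu.2.1, hu.2.2]
  refine (hA.measure_pos volume ⟨chartAt Plane x x, mem_chart_target Plane x, ?_⟩).ne' h1
  simp [(chartAt Plane x).left_inv (mem_chart_source Plane x), hx]

end Volume

/-! ### The Jacobian as a null Lagrangian on the plane -/

section NullLagrangian

/-- The coordinate functions of the model plane. -/
abbrev coordProj (k : Fin 2) : Plane →L[ℝ] ℝ := EuclideanSpace.proj k

/-- The pull-back of `w du₀ ∧ du₁` under `ψ`, evaluated on two constant vector fields. -/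
def pullbackArea (w : Plane → ℝ) (ψ : ℝ × Plane → Plane) (ξ ζ : ℝ × Plane) (q : ℝ × Plane) : ℝ :=
  w (ψ q) * det2 (fderiv ℝ ψ q ξ) (fderiv ℝ ψ q ζ)

variable {w : Plane → ℝ} {ψ : ℝ × Plane → Plane} {q : ℝ × Plane}

theorem contDiffAt_fderiv_apply (hψ : ContDiffAt ℝ 2 ψ q) (ξ : ℝ × Plane) (k : Fin 2) :
    ContDiffAt ℝ 1 (fun q => fderiv ℝ ψ q ξ k) q := by
  have h1 : ContDiffAt ℝ 1 (fun q => fderiv ℝ ψ q ξ) q :=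
    (hψ.fderiv_right (m := 1) (by norm_num)).clm_apply contDiffAt_const
  exact (coordProj k).contDiff.contDiffAt.comp q h1

theorem contDiffAt_pullbackArea (hψ : ContDiffAt ℝ 2 ψ q) (hw : ContDiffAt ℝ 1 w (ψ q))
    (ξ ζ : ℝ × Plane) : ContDiffAt ℝ 1 (pullbackArea w ψ ξ ζ) q := by
  have h := contDiffAt_fderiv_apply hψ
  exact (hw.comp q (hψ.of_le (by norm_num))).mul
    (((h ξ 0).mul (h ζ 1)).sub ((h ξ 1).mul (h ζ 0)))

theorem fderiv_pullbackArea (hψ : ContDiffAt ℝ 2 ψ q) (hw : ContDiffAt ℝ 1 w (ψ q))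
    (ξ ζ η : ℝ × Plane) : fderiv ℝ (pullbackArea w ψ ξ ζ) q η =
      fderiv ℝ w (ψ q) (fderiv ℝ ψ q η) * det2 (fderiv ℝ ψ q ξ) (fderiv ℝ ψ q ζ) +
      w (ψ q) * (det2 (fderiv ℝ (fderiv ℝ ψ) q η ξ) (fderiv ℝ ψ q ζ) +
        det2 (fderiv ℝ ψ q ξ) (fderiv ℝ (fderiv ℝ ψ) q η ζ)) := by
  have hB : HasFDerivAt (fderiv ℝ ψ) (fderiv ℝ (fderiv ℝ ψ) q) q :=
    ((hψ.fderiv_right (m := 1) (by norm_num)).differentiableAt (by norm_num)).hasFDerivAt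
  have hD : HasFDerivAt ψ (fderiv ℝ ψ q) q := (hψ.differentiableAt (by norm_num)).hasFDerivAt
  have hW : HasFDerivAt w (fderiv ℝ w (ψ q)) (ψ q) :=
    (hw.differentiableAt (by norm_num)).hasFDerivAt
  have hk : ∀ (ξ : ℝ × Plane) (k : Fin 2), HasFDerivAt (fun q => fderiv ℝ ψ q ξ k)
      ((coordProj k).comp
        ((fderiv ℝ (fderiv ℝ ψ) q).flip ξ)) q := fun ξ k =>
    (coordProj k).hasFDerivAt.comp q
      ((ContinuousLinearMap.apply ℝ Plane ξ).hasFDerivAt.comp q hB)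
  have h := (hW.comp q hD).mul (((hk ξ 0).mul (hk ζ 1)).sub ((hk ξ 1).mul (hk ζ 0)))
  have h2 : HasFDerivAt (pullbackArea w ψ ξ ζ) _ q := h
  rw [h2.fderiv]
  simp [det2]
  ring

/-- The pull-back of an area form is closed. -/
theorem fderiv_pullbackArea_closed (hψ : ContDiffAt ℝ 2 ψ q) (hw : ContDiffAt ℝ 1 w (ψ q))
    (ξ ζ η : ℝ × Plane) : fderiv ℝ (pullbackArea w ψ ζ η) q ξ =
      fderiv ℝ (pullbackArea w ψ ξ η) q ζ + fderiv ℝ (pullbackArea w ψ ζ ξ) q η := by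
  have hs : ∀ a b, fderiv ℝ (fderiv ℝ ψ) q a b = fderiv ℝ (fderiv ℝ ψ) q b a := fun a b =>
    (hψ.isSymmSndFDerivAt (by simp)) a b
  rw [fderiv_pullbackArea hψ hw, fderiv_pullbackArea hψ hw, fderiv_pullbackArea hψ hw,
    hs ζ ξ, hs η ξ, hs η ζ]
  -- The second derivatives cancel by symmetry. What is left is `dw ∧ du₀ ∧ du₁ = 0`, as every
  -- 3-form on a plane vanishes.
  have hl : ∀ v : Plane, fderiv ℝ w (ψ q) v =
      v 0 * fderiv ℝ w (ψ q) (stdVec 0) + v 1 * fderiv ℝ w (ψ q) (stdVec 1) := fun v => by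
    conv_lhs => rw [eq_smul_stdVec v]
    simp only [map_add, map_smul, smul_eq_mul]
  rw [hl (fderiv ℝ ψ q ξ), hl (fderiv ℝ ψ q ζ), hl (fderiv ℝ ψ q η)]
  simp only [det2]
  ring

/-- The flux of a variation through the coordinate directions: `fluxField w ψ 0` and
`fluxField w ψ 1` are the components of the vector field whose divergence is the variation of the
area. -/
def fluxField (w : Plane → ℝ) (ψ : ℝ × Plane → Plane) (i : Fin 2) (u : Plane) : ℝ :=
  ![pullbackArea w ψ (1, 0) (0, stdVec 1) (0, u), pullbackArea w ψ (0, stdVec 0) (1, 0) (0, u)] i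

theorem contDiffAt_fluxField {u : Plane} (hψ : ContDiffAt ℝ 2 ψ (0, u))
    (hw : ContDiffAt ℝ 1 w (ψ (0, u))) (i : Fin 2) : ContDiffAt ℝ 1 (fluxField w ψ i) u := by
  have h : ContDiffAt ℝ 1 (fun u : Plane => ((0 : ℝ), u)) u := by fun_prop
  fin_cases i
  · exact (contDiffAt_pullbackArea hψ hw (1, 0) (0, stdVec 1)).comp u h
  · exact (contDiffAt_pullbackArea hψ hw (0, stdVec 0) (1, 0)).comp u h

/-- The divergence of a planar vector field. -/
def div2 (Z : Fin 2 → Plane → ℝ) (u : Plane) : ℝ :=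
  fderiv ℝ (Z 0) u (stdVec 0) + fderiv ℝ (Z 1) u (stdVec 1)

/-- Closedness of the pull-back `ω` on the directions `∂ₜ, ∂₀, ∂₁`: `∂ₜ ω(∂₀, ∂₁) = ∂₀ ω(∂ₜ, ∂₁) +
∂₁ ω(∂₀, ∂ₜ)`. -/
theorem hasDerivAt_pullbackArea {u : Plane} (hψ : ContDiffAt ℝ 2 ψ (0, u))
    (hw : ContDiffAt ℝ 1 w (ψ (0, u))) :
    HasDerivAt (fun t => pullbackArea w ψ (0, stdVec 0) (0, stdVec 1) (t, u))
      (div2 (fluxField w ψ) u) 0 := by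
  have h : ∀ ξ ζ, HasFDerivAt (pullbackArea w ψ ξ ζ) (fderiv ℝ (pullbackArea w ψ ξ ζ) (0, u))
      (0, u) := fun ξ ζ =>
    ((contDiffAt_pullbackArea hψ hw ξ ζ).differentiableAt (by norm_num)).hasFDerivAt
  have hp : HasDerivAt (fun t : ℝ => (t, u)) ((1 : ℝ), (0 : Plane)) 0 :=
    (hasDerivAt_id _).prodMk (hasDerivAt_const _ _)
  have hq : HasFDerivAt (fun u : Plane => ((0 : ℝ), u)) (ContinuousLinearMap.inr ℝ ℝ Plane) u :=
    (ContinuousLinearMap.inr ℝ ℝ Plane).hasFDerivAt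
  have h0 := ((h (1, 0) (0, stdVec 1)).comp u hq).fderiv
  have h1 := ((h (0, stdVec 0) (1, 0)).comp u hq).fderiv
  have key := (h (0, stdVec 0) (0, stdVec 1)).comp_hasDerivAt (0 : ℝ) hp
  rw [fderiv_pullbackArea_closed hψ hw] at key
  convert! key using 1
  rw [div2]
  congr 1
  · exact congrArg (fun L : Plane →L[ℝ] ℝ => L (stdVec 0)) h0
  · exact congrArg (fun L : Plane →L[ℝ] ℝ => L (stdVec 1)) h1

/-- Integration by parts against the constant function `1`. -/
theorem integral_fderiv_eq_zero {f : Plane → ℝ} (hf : ContDiff ℝ 1 f) (hc : HasCompactSupport f)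
    (v : Plane) : ∫ u, fderiv ℝ f u v = 0 := by
  have hi : Integrable (fun u => fderiv ℝ f u v) := by
    refine Continuous.integrable_of_hasCompactSupport ?_ ?_
    · exact (hf.continuous_fderiv (by norm_num)).clm_apply continuous_const
    · exact (hc.fderiv ℝ).comp_left (g := fun L : Plane →L[ℝ] ℝ => L v) rfl
  have h := integral_mul_fderiv_eq_neg_fderiv_mul_of_integrable (μ := (volume : Measure Plane))
    (f := fun _ => (1 : ℝ)) (g := f) (v := v) (by simp) (by simpa using hi)
    (by simpa using hf.continuous.integrable_of_hasCompactSupport hc)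
    (fun x _ => differentiableAt_const _) (fun x _ => hf.differentiable (by norm_num) x)
  simpa using h

theorem integral_div2_eq_zero {Z : Fin 2 → Plane → ℝ} (hZ : ∀ i, ContDiff ℝ 1 (Z i))
    (hc : ∀ i, HasCompactSupport (Z i)) : ∫ u, div2 Z u = 0 := by
  have hi : ∀ i, Integrable (fun u => fderiv ℝ (Z i) u (stdVec i)) := fun i => by
    refine Continuous.integrable_of_hasCompactSupport ?_ ?_
    · exact ((hZ i).continuous_fderiv (by norm_num)).clm_apply continuous_const
    · exact ((hc i).fderiv ℝ).comp_left (g := fun L : Plane →L[ℝ] ℝ => L (stdVec i)) rfl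
  simp only [div2]
  rw [integral_add (hi 0) (hi 1), integral_fderiv_eq_zero (hZ 0) (hc 0),
    integral_fderiv_eq_zero (hZ 1) (hc 1), add_zero]

/-- Slowing down a variation by a factor `χ` multiplies the flux by `χ`. -/
theorem fluxField_slowdown {χ : Plane → ℝ} {u : Plane} (hψ : DifferentiableAt ℝ ψ (0, u))
    (hχ : DifferentiableAt ℝ χ u) (i : Fin 2) :
    fluxField w (fun q => ψ (q.1 * χ q.2, q.2)) i u = χ u * fluxField w ψ i u := by
  have h1 : HasFDerivAt (fun q : ℝ × Plane => q.1 * χ q.2)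
      ((0 : ℝ) • (fderiv ℝ χ u).comp (ContinuousLinearMap.snd ℝ ℝ Plane) +
        χ u • ContinuousLinearMap.fst ℝ ℝ Plane) ((0 : ℝ), u) :=
    (hasFDerivAt_fst (𝕜 := ℝ) (p := ((0 : ℝ), u))).mul
      ((hχ.hasFDerivAt (x := u)).comp ((0 : ℝ), u) hasFDerivAt_snd)
  have h2 := h1.prodMk (hasFDerivAt_snd (𝕜 := ℝ) (p := ((0 : ℝ), u)))
  have h3 : HasFDerivAt ψ (fderiv ℝ ψ (0, u)) ((fun q : ℝ × Plane => (q.1 * χ q.2, q.2)) (0, u)) := by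
    simpa using hψ.hasFDerivAt
  have h4 := (h3.comp ((0 : ℝ), u) h2).fderiv
  -- The gradient of `χ` comes with the factor `t = 0`, so only the time component is rescaled.
  have h5 : ∀ ξ : ℝ × Plane, fderiv ℝ (fun q : ℝ × Plane => ψ (q.1 * χ q.2, q.2)) (0, u) ξ =
      fderiv ℝ ψ (0, u) (χ u * ξ.1, ξ.2) := by
    intro ξ
    have := congrArg (fun L : ℝ × Plane →L[ℝ] Plane => L ξ) h4
    simpa [Function.comp_def] using this
  have h6 : fderiv ℝ ψ (0, u) (χ u, 0) = χ u • fderiv ℝ ψ (0, u) (1, 0) := by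
    rw [← map_smul]; simp
  fin_cases i <;> simp [fluxField, pullbackArea, h5, det2, h6] <;> ring

end NullLagrangian

/-! ### Families of maps: regularity of norm and Jacobian -/

section Families

variable {X : Type*} [TopologicalSpace X] [ChartedSpace Plane X] [IsManifold (𝓡 2) ∞ X]
  {Y : Type*} [TopologicalSpace Y] [ChartedSpace Plane Y] [IsManifold (𝓡 2) ∞ Y]

/-- A family of maps that is jointly `C²` at a point. -/
abbrev JointC2At (Φ : ℝ → X → Y) (t : ℝ) (x : X) : Prop :=
  ContMDiffAt (𝓘(ℝ, ℝ).prod (𝓡 2)) (𝓡 2) 2 (fun q : ℝ × X => Φ q.1 q.2) (t, x)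

/-- A family of maps in charts. -/
def localMap (x₀ : X) (y₀ : Y) (Φ : ℝ → X → Y) (q : ℝ × Plane) : Plane :=
  inCharts x₀ y₀ (Φ q.1) q.2

variable {Φ : ℝ → X → Y} {t : ℝ} {x₀ : X} {y₀ : Y} {u : Plane}

theorem JointC2At.mdifferentiableAt {x : X} (h : JointC2At Φ t x) :
    MDifferentiableAt (𝓡 2) (𝓡 2) (Φ t) x := by
  have h2 : ContMDiffAt (𝓡 2) (𝓘(ℝ, ℝ).prod (𝓡 2)) 2 (fun x : X => (t, x)) x :=
    contMDiffAt_const.prodMk contMDiffAt_id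
  exact (ContMDiffAt.comp x h h2).mdifferentiableAt (by norm_num)

theorem contMDiffAt_prod_chart_symm (hu : u ∈ (chartAt Plane x₀).target) (n : ℕ∞) :
    ContMDiffAt 𝓘(ℝ, ℝ × Plane) (𝓘(ℝ, ℝ).prod (𝓡 2)) n
      (fun q : ℝ × Plane => (q.1, (chartAt Plane x₀).symm q.2)) (t, u) := by
  have h1 : ContMDiffAt 𝓘(ℝ, ℝ × Plane) 𝓘(ℝ, ℝ) n (fun q : ℝ × Plane => q.1) (t, u) :=
    contDiff_fst.contMDiff.contMDiffAt
  have h2 : ContMDiffAt 𝓘(ℝ, ℝ × Plane) (𝓡 2) n (fun q : ℝ × Plane => q.2) (t, u) :=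
    contDiff_snd.contMDiff.contMDiffAt
  have h3 : ContMDiffAt (𝓡 2) (𝓡 2) n (chartAt Plane x₀).symm u :=
    ((contMDiffOn_chart_symm (n := ∞)).contMDiffAt (eventually_chart_target hu)).of_le
      (by exact_mod_cast le_top)
  exact h1.prodMk (ContMDiffAt.comp (t, u) h3 h2)

theorem JointC2At.contDiffAt_localMap (hu : u ∈ (chartAt Plane x₀).target)
    (h : JointC2At Φ t ((chartAt Plane x₀).symm u))
    (hy : Φ t ((chartAt Plane x₀).symm u) ∈ (chartAt Plane y₀).source) :
    ContDiffAt ℝ 2 (localMap x₀ y₀ Φ) (t, u) := by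
  rw [← contMDiffAt_iff_contDiffAt]
  have h1 := ContMDiffAt.comp (t, u) h (contMDiffAt_prod_chart_symm hu 2)
  have h3 : ContMDiffAt (𝓡 2) (𝓡 2) 2 (chartAt Plane y₀) (Φ t ((chartAt Plane x₀).symm u)) :=
    ((contMDiffOn_chart (n := ∞)).contMDiffAt ((chartAt Plane y₀).open_source.mem_nhds hy)).of_le
      ENat.LEInfty.out
  exact ContMDiffAt.comp (t, u) h3 h1

theorem JointC2At.eventually (hu : u ∈ (chartAt Plane x₀).target)
    (h : JointC2At Φ t ((chartAt Plane x₀).symm u))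
    (hy : Φ t ((chartAt Plane x₀).symm u) ∈ (chartAt Plane y₀).source) :
    ∀ᶠ q : ℝ × Plane in 𝓝 (t, u), q.2 ∈ (chartAt Plane x₀).target ∧
      JointC2At Φ q.1 ((chartAt Plane x₀).symm q.2) ∧
      Φ q.1 ((chartAt Plane x₀).symm q.2) ∈ (chartAt Plane y₀).source := by
  have hc := (contMDiffAt_prod_chart_symm (t := t) hu 2).continuousAt
  have e1 := hc.eventually ((contMDiffAt_iff_contMDiffAt_nhds (by decide)).1 h)
  have h1 := (ContMDiffAt.comp (t, u) h (contMDiffAt_prod_chart_symm hu 2)).continuousAt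
  have e2 := h1.preimage_mem_nhds ((chartAt Plane y₀).open_source.mem_nhds hy)
  have e3 : ∀ᶠ q : ℝ × Plane in 𝓝 (t, u), q.2 ∈ (chartAt Plane x₀).target :=
    continuousAt_snd.eventually (eventually_chart_target hu)
  filter_upwards [e1, e2, e3] with q h1 h2 h3 using ⟨h3, h1, h2⟩

theorem fderiv_localMap {q : ℝ × Plane} (h : DifferentiableAt ℝ (localMap x₀ y₀ Φ) q) (v : Plane) :
    fderiv ℝ (localMap x₀ y₀ Φ) q (0, v) = fderiv ℝ (inCharts x₀ y₀ (Φ q.1)) q.2 v := by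
  have hq : HasFDerivAt (fun u : Plane => (q.1, u)) (ContinuousLinearMap.inr ℝ ℝ Plane) q.2 :=
    hasFDerivAt_prodMk_right _ _
  have h1 := ((h.hasFDerivAt (x := (q.1, q.2))).comp q.2 hq).fderiv
  exact (congrArg (fun L : Plane →L[ℝ] Plane => L v) h1).symm

variable [Bundle.RiemannianBundle (fun x : X => TangentSpace (𝓡 2) x)]
  [Bundle.RiemannianBundle (fun y : Y => TangentSpace (𝓡 2) y)]

/-- The Jacobian of a map at a point. -/
def jacAt (oX : SurfaceOrientation X) (oY : SurfaceOrientation Y) (φ : X → Y) (x : X) : ℝ :=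
  jac (oX.at_point x) (oY.at_point (φ x)) (diff φ x)

/-- The squared norm of the differential of a map at a point. -/
def normSqAt (φ : X → Y) (x : X) : ℝ := frobeniusNorm (diff φ x) ^ 2

/-- The type of `diff φ x` depends on `φ x`, so the comparison passes through a formula in the model
plane, where point and differential can be rewritten. -/
theorem jacAt_congr (oX : SurfaceOrientation X) (oY : SurfaceOrientation Y) {φ φ' : X → Y} {x : X}
    (h : φ =ᶠ[𝓝 x] φ') : jacAt oX oY φ x = jacAt oX oY φ' x := by
  have e : ∀ φ : X → Y, jacAt oX oY φ x = tangentArea oY (φ x)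
      (planeDiff φ x (orthoBasis (oX.at_point x) 0))
      (planeDiff φ x (orthoBasis (oX.at_point x) 1)) := fun φ => jac_eq_areaForm _ _ _
  have hd : planeDiff φ x = planeDiff φ' x := h.mfderiv_eq
  rw [e, e, h.eq_of_nhds, hd]

theorem normSqAt_congr (oX : SurfaceOrientation X) {φ φ' : X → Y} {x : X}
    (h : φ =ᶠ[𝓝 x] φ') : normSqAt φ x = normSqAt φ' x := by
  have e : ∀ φ : X → Y, normSqAt φ x =
      tangentInner (φ x) (planeDiff φ x (orthoBasis (oX.at_point x) 0))
        (planeDiff φ x (orthoBasis (oX.at_point x) 0)) +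
      tangentInner (φ x) (planeDiff φ x (orthoBasis (oX.at_point x) 1))
        (planeDiff φ x (orthoBasis (oX.at_point x) 1)) := fun φ => by
    have h := frobeniusNorm_sq (orthoBasis (oX.at_point x)) (diff φ x)
    rw [← real_inner_self_eq_norm_sq, ← real_inner_self_eq_norm_sq] at h
    exact h
  have hd : planeDiff φ x = planeDiff φ' x := h.mfderiv_eq
  rw [e, e, h.eq_of_nhds, hd]

theorem jacAt_mul_chartArea (oX : SurfaceOrientation X) (oY : SurfaceOrientation Y)
    (hu : u ∈ (chartAt Plane x₀).target) (h : JointC2At Φ t ((chartAt Plane x₀).symm u))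
    (hy : Φ t ((chartAt Plane x₀).symm u) ∈ (chartAt Plane y₀).source) :
    jacAt oX oY (Φ t) ((chartAt Plane x₀).symm u) * chartArea oX x₀ u =
      pullbackArea (chartArea oY y₀) (localMap x₀ y₀ Φ) (0, stdVec 0) (0, stdVec 1) (t, u) := by
  have hd := (h.contDiffAt_localMap hu hy).differentiableAt (by norm_num)
  rw [pullbackArea, fderiv_localMap hd, fderiv_localMap hd, mul_comm (chartArea oY y₀ _)]
  exact jac_mul_chartArea oX oY hu h.mdifferentiableAt hy

variable [IsContMDiffRiemannianBundle (𝓡 2) ∞ Plane (fun x : X => TangentSpace (𝓡 2) x)]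
  [IsContMDiffRiemannianBundle (𝓡 2) ∞ Plane (fun y : Y => TangentSpace (𝓡 2) y)]

theorem localMap_mem_target
    (hy : Φ t ((chartAt Plane x₀).symm u) ∈ (chartAt Plane y₀).source) :
    localMap x₀ y₀ Φ (t, u) ∈ (chartAt Plane y₀).target := (chartAt Plane y₀).map_source hy

/-- Near the point it is a quotient of a pulled-back area component by the nonvanishing one of the
domain; one of the two derivatives is spent on the differential. -/
theorem contDiffAt_jacAt (oX : SurfaceOrientation X) (oY : SurfaceOrientation Y)
    (hu : u ∈ (chartAt Plane x₀).target) (h : JointC2At Φ t ((chartAt Plane x₀).symm u)) :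
    ContDiffAt ℝ 1 (fun q : ℝ × Plane => jacAt oX oY (Φ q.1) ((chartAt Plane x₀).symm q.2))
      (t, u) := by
  have hy := mem_chart_source Plane (Φ t ((chartAt Plane x₀).symm u))
  set y₀ := Φ t ((chartAt Plane x₀).symm u) with hy₀
  have hw : ContDiffAt ℝ 1 (fun q : ℝ × Plane => chartArea oX x₀ q.2) (t, u) :=
    ((contDiffAt_chartArea oX hu).of_le (by exact_mod_cast le_top)).comp (t, u) contDiffAt_snd
  have hp := contDiffAt_pullbackArea (h.contDiffAt_localMap hu hy)
    ((contDiffAt_chartArea oY (localMap_mem_target hy)).of_le (by exact_mod_cast le_top))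
    (0, stdVec 0) (0, stdVec 1)
  refine (hp.div hw (chartArea_ne_zero oX hu)).congr_of_eventuallyEq ?_
  filter_upwards [h.eventually hu hy] with q hq
  rw [Pi.div_apply, eq_div_iff (chartArea_ne_zero oX hq.1)]
  exact jacAt_mul_chartArea oX oY hq.1 hq.2.1 hq.2.2

theorem contDiffAt_normSqAt (oX : SurfaceOrientation X)
    (hu : u ∈ (chartAt Plane x₀).target) (h : JointC2At Φ t ((chartAt Plane x₀).symm u)) :
    ContDiffAt ℝ 1 (fun q : ℝ × Plane => normSqAt (Φ q.1) ((chartAt Plane x₀).symm q.2))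
      (t, u) := by
  have hy := mem_chart_source Plane (Φ t ((chartAt Plane x₀).symm u))
  set y₀ := Φ t ((chartAt Plane x₀).symm u) with hy₀
  have hw : ContDiffAt ℝ 1 (fun q : ℝ × Plane => chartArea oX x₀ q.2) (t, u) :=
    ((contDiffAt_chartArea oX hu).of_le (by exact_mod_cast le_top)).comp (t, u) contDiffAt_snd
  have hψ := h.contDiffAt_localMap hu hy
  have hI : ∀ v w, ContDiffAt ℝ 1 (fun q : ℝ × Plane => chartInner x₀ q.2 v w) (t, u) :=
    fun v w => (((contDiffOn_chartInner x₀ v w).contDiffAt (eventually_chart_target hu)).of_le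
      (by exact_mod_cast le_top)).comp (t, u) contDiffAt_snd
  have hI' : ∀ v w, ContDiffAt ℝ 1
      (fun q : ℝ × Plane => chartInner y₀ (localMap x₀ y₀ Φ q) v w) (t, u) :=
    fun v w => (((contDiffOn_chartInner y₀ v w).contDiffAt
      (eventually_chart_target (localMap_mem_target hy))).of_le
        (by exact_mod_cast le_top)).comp (t, u) (hψ.of_le (by norm_num))
  have hD := fun v k => contDiffAt_fderiv_apply hψ v k
  -- Base point and vectors vary together; expanding in the standard basis separates the two
  -- dependences.
  have hJ : ∀ ξ ζ, ContDiffAt ℝ 1 (fun q : ℝ × Plane => chartInner y₀ (localMap x₀ y₀ Φ q)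
      (fderiv ℝ (localMap x₀ y₀ Φ) q ξ) (fderiv ℝ (localMap x₀ y₀ Φ) q ζ)) (t, u) := by
    intro ξ ζ
    simp only [chartInner_expand y₀ _ (fderiv ℝ (localMap x₀ y₀ Φ) _ ξ)]
    exact ((((hD ξ 0).mul (hD ζ 0)).mul (hI' _ _)).add
      ((((hD ξ 0).mul (hD ζ 1)).add ((hD ξ 1).mul (hD ζ 0))).mul (hI' _ _))).add
      (((hD ξ 1).mul (hD ζ 1)).mul (hI' _ _))
  have hN := (((hI (stdVec 1) (stdVec 1)).mul (hJ (0, stdVec 0) (0, stdVec 0))).sub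
    (((contDiffAt_const (c := (2 : ℝ))).mul (hI (stdVec 0) (stdVec 1))).mul
      (hJ (0, stdVec 0) (0, stdVec 1)))).add
    ((hI (stdVec 0) (stdVec 0)).mul (hJ (0, stdVec 1) (0, stdVec 1)))
  refine (hN.div (hw.pow 2) (pow_ne_zero 2 (chartArea_ne_zero oX hu))).congr_of_eventuallyEq ?_
  filter_upwards [h.eventually hu hy] with q hq
  have hd := (hq.2.1.contDiffAt_localMap hq.1 hq.2.2).differentiableAt (by norm_num)
  simp only [Pi.div_apply]
  rw [eq_div_iff (pow_ne_zero 2 (chartArea_ne_zero oX hq.1))]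
  have := frobeniusNorm_sq_mul_chartArea_sq oX hq.1 hq.2.1.mdifferentiableAt hq.2.2
  simp only [fderiv_localMap hd]
  exact this

/-- The variation of the Jacobian is a divergence. -/
theorem hasDerivAt_jacAt_mul (oX : SurfaceOrientation X) (oY : SurfaceOrientation Y)
    (hu : u ∈ (chartAt Plane x₀).target) (h : JointC2At Φ 0 ((chartAt Plane x₀).symm u))
    (hy : Φ 0 ((chartAt Plane x₀).symm u) ∈ (chartAt Plane y₀).source) :
    HasDerivAt (fun t => jacAt oX oY (Φ t) ((chartAt Plane x₀).symm u))
      (div2 (fluxField (chartArea oY y₀) (localMap x₀ y₀ Φ)) u / chartArea oX x₀ u) 0 := by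
  have h1 := hasDerivAt_pullbackArea (h.contDiffAt_localMap hu hy)
    ((contDiffAt_chartArea oY (localMap_mem_target hy)).of_le (by exact_mod_cast le_top))
  refine (h1.div_const (chartArea oX x₀ u)).congr_of_eventuallyEq ?_
  have hc : ContinuousAt (fun t : ℝ => (t, u)) 0 := by fun_prop
  filter_upwards [hc.eventually (h.eventually hu hy)] with t ht
  rw [eq_div_iff (chartArea_ne_zero oX hu)]
  exact jacAt_mul_chartArea oX oY hu ht.2.1 ht.2.2

end Families

/-! ### First variation of the energy -/

section EnergyDerivative

variable {X : Type*} [TopologicalSpace X] [ChartedSpace Plane X] [IsManifold (𝓡 2) ∞ X]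
  {Y : Type*} [TopologicalSpace Y] [ChartedSpace Plane Y] [IsManifold (𝓡 2) ∞ Y]
  [Bundle.RiemannianBundle (fun x : X => TangentSpace (𝓡 2) x)]
  [Bundle.RiemannianBundle (fun y : Y => TangentSpace (𝓡 2) y)]

section Variation

variable {M : Set X} {N : Set Y} {φ : X → Y} {ε : ℝ} {Φ : ℝ → X → Y}

theorem IsVariation.zero_mem (hV : IsVariation M N φ ε Φ) : (0 : ℝ) ∈ Ioo (-ε) ε := by
  simp [hV.pos]

theorem IsVariation.jointC2At (hV : IsVariation M N φ ε Φ) {t : ℝ} (ht : t ∈ Ioo (-ε) ε) {x : X}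
    (hx : x ∈ interior M) : JointC2At Φ t x :=
  hV.contMDiffOn.contMDiffAt (prod_mem_nhds (Ioo_mem_nhds ht.1 ht.2)
    (mem_interior_iff_mem_nhds.1 hx))

theorem IsVariation.zero_eventuallyEq (hV : IsVariation M N φ ε Φ) {x : X}
    (hx : x ∈ interior M) : Φ 0 =ᶠ[𝓝 x] φ := by
  filter_upwards [mem_interior_iff_mem_nhds.1 hx] with z hz using hV.zero z hz

theorem IsVariation.exists_compact [T2Space X] (hV : IsVariation M N φ ε Φ) :
    ∃ C : Set X, IsCompact C ∧ C ⊆ interior M ∧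
      ∀ t ∈ Ioo (-ε) ε, ∀ x ∈ interior M \ C, Φ t =ᶠ[𝓝 x] φ := by
  obtain ⟨C, hC, hCM, h⟩ := hV.eq_outside
  refine ⟨C, hC, hCM, fun t ht x hx => ?_⟩
  filter_upwards [(isOpen_interior.sdiff hC.isClosed).mem_nhds hx] with z hz
  exact h t ht z ⟨interior_subset hz.1, hz.2⟩

end Variation

/-- The energy density `dist^p(dφ, SO)`. -/
def energyDensity (oX : SurfaceOrientation X) (oY : SurfaceOrientation Y) (p : ℝ) (φ : X → Y)
    (x : X) : ℝ :=
  sqDist (normSqAt φ x) (jacAt oX oY φ x) ^ (p / 2)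

theorem energyDensity_congr (oX : SurfaceOrientation X) (oY : SurfaceOrientation Y) (p : ℝ)
    {φ φ' : X → Y} {x : X} (h : φ =ᶠ[𝓝 x] φ') :
    energyDensity oX oY p φ x = energyDensity oX oY p φ' x := by
  rw [energyDensity, jacAt_congr oX oY h, normSqAt_congr oX h, energyDensity]

theorem energy_eq [MeasurableSpace X] (oX : SurfaceOrientation X) (oY : SurfaceOrientation Y)
    (M : Set X) (p : ℝ) (φ : X → Y) : energy oX oY M p φ =
      ((riemannianVolume X).real M)⁻¹ * ∫ x in M, energyDensity oX oY p φ x ∂(riemannianVolume X) := by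
  have h : ∀ x, distSO (oX.at_point x) (oY.at_point (φ x)) (diff φ x) ^ p =
      energyDensity oX oY p φ x := fun x => distSO_rpow _ _ _ _
  rw [energy]
  simp only [h]
  rw [setAverage_eq, smul_eq_mul]

/-- The pointwise condition `dφ ∈ K` in terms of norm and Jacobian. -/
def InWellAt (oX : SurfaceOrientation X) (oY : SurfaceOrientation Y) (φ : X → Y) (x : X) : Prop :=
  normSqAt φ x + 2 * jacAt oX oY φ x = 1 ∧ 0 ≤ jacAt oX oY φ x ∧ jacAt oX oY φ x ≤ 1 / 4

theorem inWellAt_of_mem_wellK (oX : SurfaceOrientation X) (oY : SurfaceOrientation Y) {φ : X → Y}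
    {x : X} (h : diff φ x ∈ wellK (oX.at_point x) (oY.at_point (φ x))) : InWellAt oX oY φ x :=
  ⟨frobeniusNorm_sq_add_of_mem_wellK _ _ h, h.1, jac_le_of_mem_wellK _ _ h⟩

theorem InWellAt.congr {oX : SurfaceOrientation X} {oY : SurfaceOrientation Y} {φ φ' : X → Y}
    {x : X} (h : InWellAt oX oY φ x) (hφ : φ' =ᶠ[𝓝 x] φ) : InWellAt oX oY φ' x := by
  rwa [InWellAt, jacAt_congr oX oY hφ, normSqAt_congr oX hφ]

theorem InWellAt.sqDist_eq {oX : SurfaceOrientation X} {oY : SurfaceOrientation Y} {φ : X → Y}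
    {x : X} (h : InWellAt oX oY φ x) :
    sqDist (normSqAt φ x) (jacAt oX oY φ x) = 1 - 2 * jacAt oX oY φ x := by
  rw [sqDist, h.1, Real.sqrt_one]
  linarith [h.1]

/-- The variation of the Jacobian. -/
def jacVariation (oX : SurfaceOrientation X) (oY : SurfaceOrientation Y) (Φ : ℝ → X → Y) (x : X) :
    ℝ := deriv (fun t => jacAt oX oY (Φ t) x) 0

variable [IsContMDiffRiemannianBundle (𝓡 2) ∞ Plane (fun x : X => TangentSpace (𝓡 2) x)]
  [IsContMDiffRiemannianBundle (𝓡 2) ∞ Plane (fun y : Y => TangentSpace (𝓡 2) y)]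
  {Φ : ℝ → X → Y} {t : ℝ} {x : X} (oX : SurfaceOrientation X) (oY : SurfaceOrientation Y)

theorem contDiffAt_jacAt_chart (h : JointC2At Φ t x) :
    ContDiffAt ℝ 1 (fun q : ℝ × Plane => jacAt oX oY (Φ q.1) ((chartAt Plane x).symm q.2))
      (t, chartAt Plane x x) := by
  refine contDiffAt_jacAt oX oY (mem_chart_target Plane x) ?_
  rwa [(chartAt Plane x).left_inv (mem_chart_source Plane x)]

theorem contDiffAt_normSqAt_chart (oX : SurfaceOrientation X) (h : JointC2At Φ t x) :
    ContDiffAt ℝ 1 (fun q : ℝ × Plane => normSqAt (Φ q.1) ((chartAt Plane x).symm q.2))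
      (t, chartAt Plane x x) := by
  refine contDiffAt_normSqAt oX (mem_chart_target Plane x) ?_
  rwa [(chartAt Plane x).left_inv (mem_chart_source Plane x)]

theorem continuousAt_of_chart {f : X → ℝ}
    (h : ContinuousAt (fun u => f ((chartAt Plane x).symm u)) (chartAt Plane x x)) :
    ContinuousAt f x := by
  have h1 : ContinuousAt (chartAt Plane x) x :=
    (chartAt Plane x).continuousAt (mem_chart_source Plane x)
  refine (ContinuousAt.comp (f := chartAt Plane x) h h1).congr ?_
  filter_upwards [(chartAt Plane x).open_source.mem_nhds (mem_chart_source Plane x)] with z hz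
  simp [(chartAt Plane x).left_inv hz]

theorem continuousAt_jacAt (h : JointC2At Φ t x) : ContinuousAt (jacAt oX oY (Φ t)) x := by
  have hc : ContinuousAt (fun u : Plane => (t, u)) (chartAt Plane x x) := by fun_prop
  exact continuousAt_of_chart
    (ContinuousAt.comp (f := fun u : Plane => (t, u)) (contDiffAt_jacAt_chart oX oY h).continuousAt hc)

theorem continuousAt_normSqAt (oX : SurfaceOrientation X) (h : JointC2At Φ t x) : ContinuousAt (normSqAt (Φ t)) x := by
  have hc : ContinuousAt (fun u : Plane => (t, u)) (chartAt Plane x x) := by fun_prop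
  exact continuousAt_of_chart
    (ContinuousAt.comp (f := fun u : Plane => (t, u)) (contDiffAt_normSqAt_chart oX h).continuousAt hc)

/-- For `t ≠ 0` the differential may leave the well and the base may vanish. Continuity survives
because `p > 0`, and it gives measurability. -/
theorem continuousAt_energyDensity {p : ℝ} (hp : 0 < p) (h : JointC2At Φ t x) :
    ContinuousAt (energyDensity oX oY p (Φ t)) x := by
  have h1 := continuousAt_jacAt oX oY h
  have h2 := continuousAt_normSqAt oX h
  refine ContinuousAt.rpow_const ?_ (Or.inr (by positivity))
  exact (h2.add continuousAt_const).sub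
    (continuousAt_const.mul (h2.add (continuousAt_const.mul h1)).sqrt)

theorem differentiableAt_jacAt (h : JointC2At Φ t x) :
    DifferentiableAt ℝ (fun t => jacAt oX oY (Φ t) x) t := by
  have hd := (contDiffAt_jacAt_chart oX oY h).differentiableAt (by norm_num)
  have hc : DifferentiableAt ℝ (fun t : ℝ => (t, chartAt Plane x x)) t := by fun_prop
  have := DifferentiableAt.comp (f := fun t : ℝ => (t, chartAt Plane x x)) t hd hc
  simpa [Function.comp_def, (chartAt Plane x).left_inv (mem_chart_source Plane x)] using this

theorem differentiableAt_normSqAt (oX : SurfaceOrientation X) (h : JointC2At Φ t x) :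
    DifferentiableAt ℝ (fun t => normSqAt (Φ t) x) t := by
  have hd := (contDiffAt_normSqAt_chart oX h).differentiableAt (by norm_num)
  have hc : DifferentiableAt ℝ (fun t : ℝ => (t, chartAt Plane x x)) t := by fun_prop
  have := DifferentiableAt.comp (f := fun t : ℝ => (t, chartAt Plane x x)) t hd hc
  simpa [Function.comp_def, (chartAt Plane x).left_inv (mem_chart_source Plane x)] using this

/-- The time derivative is one component of the joint derivative of a `C¹` function of `(t, u)`. -/
theorem continuousAt_jacVariation (h : JointC2At Φ 0 x) :
    ContinuousAt (jacVariation oX oY Φ) x := by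
  have hf := contDiffAt_jacAt_chart oX oY h
  refine continuousAt_of_chart ?_
  have hc : ContinuousAt (fun u : Plane => ((0 : ℝ), u)) (chartAt Plane x x) := by fun_prop
  have h1 : ContinuousAt (fun u : Plane => fderiv ℝ (fun q : ℝ × Plane =>
      jacAt oX oY (Φ q.1) ((chartAt Plane x).symm q.2)) (0, u) (1, 0)) (chartAt Plane x x) :=
    (ContinuousAt.comp (f := fun u : Plane => ((0 : ℝ), u))
      (hf.fderiv_right (m := 0) (by norm_num)).continuousAt hc).clm_apply continuousAt_const
  refine h1.congr ?_
  have hev := hc.eventually (hf.eventually (by decide))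
  filter_upwards [hev] with u hu
  have hp : HasDerivAt (fun t : ℝ => (t, u)) ((1 : ℝ), (0 : Plane)) 0 :=
    (hasDerivAt_id _).prodMk (hasDerivAt_const _ _)
  exact ((hu.differentiableAt (by norm_num)).hasFDerivAt.comp_hasDerivAt (0 : ℝ) hp).deriv.symm

/-- With radicand `1`, the derivative of `n + 2 - 2√(n + 2J)` is `n' - (n' + 2J') = -2J'`; the outer
power contributes `(p/2)(1 - 2J)^(p/2 - 1)`. -/
theorem hasDerivAt_energyDensity (p : ℝ) (h : JointC2At Φ 0 x) (hK : InWellAt oX oY (Φ 0) x) :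
    HasDerivAt (fun t => energyDensity oX oY p (Φ t) x)
      (-p * ((1 - 2 * jacAt oX oY (Φ 0) x) ^ (p / 2 - 1) * jacVariation oX oY Φ x)) 0 := by
  have hj := (differentiableAt_jacAt oX oY h).hasDerivAt
  have hn := (differentiableAt_normSqAt oX h).hasDerivAt
  have hs := hK.sqDist_eq
  have hne : sqDist (normSqAt (Φ 0) x) (jacAt oX oY (Φ 0) x) ≠ 0 := by
    rw [hs]; linarith [hK.2.2]
  have h1 := (hn.add (hj.const_mul 2)).sqrt (by rw [Pi.add_apply, hK.1]; norm_num)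
  have h2 := ((hn.add_const 2).sub (h1.const_mul 2)).rpow_const (p := p / 2) (Or.inl hne)
  convert! h2 using 1
  simp only [Pi.add_apply, hK.1, Real.sqrt_one]
  have h3 : normSqAt (Φ 0) x + 2 - 2 * 1 = 1 - 2 * jacAt oX oY (Φ 0) x := by linarith [hK.1]
  simp only [Pi.sub_apply, hK.1, Real.sqrt_one, h3, jacVariation]
  ring

theorem contDiffAt_energyDensity_chart (p : ℝ) (h : JointC2At Φ 0 x)
    (hK : InWellAt oX oY (Φ 0) x) : ContDiffAt ℝ 1 (fun q : ℝ × Plane =>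
      energyDensity oX oY p (Φ q.1) ((chartAt Plane x).symm q.2)) (0, chartAt Plane x x) := by
  have h1 := contDiffAt_jacAt_chart oX oY h
  have h2 := contDiffAt_normSqAt_chart oX h
  have hl := (chartAt Plane x).left_inv (mem_chart_source Plane x)
  have hs := hK.sqDist_eq
  refine ContDiffAt.rpow_const_of_ne (ContDiffAt.sub (h2.add contDiffAt_const)
    (contDiffAt_const.mul (ContDiffAt.sqrt (h2.add (contDiffAt_const.mul h1)) ?_))) ?_
  · simp only [hl, hK.1]; norm_num
  · simp only [hl]
    rw [hs]
    linarith [hK.2.2]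

theorem exists_lipschitz_energyDensity (p : ℝ) (h : JointC2At Φ 0 x)
    (hK : InWellAt oX oY (Φ 0) x) : ∃ U ∈ 𝓝 x, ∃ B : NNReal, ∃ δ > 0, ∀ z ∈ U,
      LipschitzOnWith B (fun t => energyDensity oX oY p (Φ t) z) (Metric.ball 0 δ) := by
  obtain ⟨B, T, hT, hB⟩ := (contDiffAt_energyDensity_chart oX oY p h hK).exists_lipschitzOnWith
  obtain ⟨T1, hT1, T2, hT2, hT12⟩ := mem_nhds_prod_iff.1 hT
  obtain ⟨δ, hδ, hδT⟩ := Metric.mem_nhds_iff.1 hT1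
  have hc : ContinuousAt (chartAt Plane x) x :=
    (chartAt Plane x).continuousAt (mem_chart_source Plane x)
  refine ⟨_, Filter.inter_mem (hc.preimage_mem_nhds hT2)
    ((chartAt Plane x).open_source.mem_nhds (mem_chart_source Plane x)), B, δ, hδ, ?_⟩
  rintro z ⟨hz, hzs⟩ a ha b hb
  have := hB (hT12 (mk_mem_prod (hδT ha) hz)) (hT12 (mk_mem_prod (hδT hb) hz))
  simpa [(chartAt Plane x).left_inv hzs, Prod.edist_eq] using this

/-- Near `t = 0` the density is `C¹` in a chart, hence locally Lipschitz in time. Compactness gives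
one constant, the dominating function for differentiating the integral. -/
theorem exists_uniform_lipschitz_energyDensity (p : ℝ) {C : Set X} (hC : IsCompact C)
    (h : ∀ x ∈ C, JointC2At Φ 0 x) (hK : ∀ x ∈ C, InWellAt oX oY (Φ 0) x) :
    ∃ B : NNReal, ∃ δ > 0, ∀ z ∈ C,
      LipschitzOnWith B (fun t => energyDensity oX oY p (Φ t) z) (Metric.ball 0 δ) := by
  refine hC.induction_on (p := fun S => ∃ B : NNReal, ∃ δ > 0, ∀ z ∈ S,
      LipschitzOnWith B (fun t => energyDensity oX oY p (Φ t) z) (Metric.ball 0 δ))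
    ⟨0, 1, one_pos, by simp⟩ ?_ ?_ ?_
  · rintro s t hst ⟨B, δ, hδ, hB⟩
    exact ⟨B, δ, hδ, fun z hz => hB z (hst hz)⟩
  · rintro s t ⟨B, δ, hδ, hB⟩ ⟨B', δ', hδ', hB'⟩
    refine ⟨max B B', min δ δ', lt_min hδ hδ', fun z hz => ?_⟩
    rcases hz with hz | hz
    · exact ((hB z hz).mono (Metric.ball_subset_ball (min_le_left _ _))).weaken (le_max_left _ _)
    · exact ((hB' z hz).mono (Metric.ball_subset_ball (min_le_right _ _))).weaken (le_max_right _ _)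
  · intro x hx
    obtain ⟨U, hU, B, δ, hδ, hB⟩ := exists_lipschitz_energyDensity oX oY p (h x hx) (hK x hx)
    exact ⟨U, mem_nhdsWithin_of_mem_nhds hU, B, δ, hδ, hB⟩

variable [MeasurableSpace X] [BorelSpace X] {M : Set X} {N : Set Y} {φ : X → Y} {ε : ℝ}

/-- On the frontier `mfderiv` also sees values outside `M`, about which nothing is assumed; these
points form a null set. -/
theorem restrict_interior_eq (hM : IsCompactSurface M) :
    (riemannianVolume X).restrict M = (riemannianVolume X).restrict (interior M) := by
  refine Measure.restrict_congr_set (Filter.EventuallyEq.symm ?_)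
  refine interior_subset.eventuallyLE.antisymm ?_
  rw [ae_le_set]
  refine measure_mono_null ?_ hM.volume_frontier
  exact sdiff_subset_sdiff_left subset_closure

/-- The first variation of the energy at a map into the well. -/
theorem hasDerivAt_energy [T2Space X] [SecondCountableTopology X] (hM : IsCompactSurface M)
    {p : ℝ} (hp : 0 < p) (hK : ∀ x ∈ interior M, InWellAt oX oY φ x)
    (hV : IsVariation M N φ ε Φ) :
    HasDerivAt (fun t => energy oX oY M p (Φ t))
      (((riemannianVolume X).real M)⁻¹ * (-p * ∫ x in interior M,
        (1 - 2 * jacAt oX oY φ x) ^ (p / 2 - 1) * jacVariation oX oY Φ x ∂(riemannianVolume X)))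
      0 := by
  have h0 := hV.zero_mem
  have hK0 : ∀ x ∈ interior M, InWellAt oX oY (Φ 0) x := fun x hx =>
    (hK x hx).congr (hV.zero_eventuallyEq hx)
  have hJ0 : ∀ x ∈ interior M, jacAt oX oY (Φ 0) x = jacAt oX oY φ x := fun x hx =>
    jacAt_congr oX oY (hV.zero_eventuallyEq hx)
  have hjoint : ∀ x ∈ interior M, JointC2At Φ 0 x := fun x hx => hV.jointC2At h0 hx
  have hmI : MeasurableSet (interior M) := isOpen_interior.measurableSet
  have hfin : riemannianVolume X (interior M) < ⊤ :=
    (measure_mono interior_subset).trans_lt (riemannianVolume_lt_top oX hM.isCompact)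
  have : IsFiniteMeasure ((riemannianVolume X).restrict (interior M)) :=
    isFiniteMeasure_restrict.2 hfin.ne
  obtain ⟨C, hC, hCM, hout⟩ := hV.exists_compact
  obtain ⟨B, δ, hδ, hB⟩ := exists_uniform_lipschitz_energyDensity oX oY p hC
    (fun x hx => hjoint x (hCM hx)) (fun x hx => hK0 x (hCM hx))
  have hcont : ∀ t ∈ Ioo (-ε) ε, ContinuousOn (energyDensity oX oY p (Φ t)) (interior M) :=
    fun t ht x hx => (continuousAt_energyDensity oX oY hp (hV.jointC2At ht hx)).continuousWithinAt
  have hball : Metric.ball (0 : ℝ) (min δ ε) ⊆ Ioo (-ε) ε := by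
    rw [Real.ball_eq_Ioo]
    exact Ioo_subset_Ioo (by simp) (by simp)
  have key := (hasDerivAt_integral_of_dominated_loc_of_lip
    (μ := (riemannianVolume X).restrict (interior M))
    (F := fun t x => energyDensity oX oY p (Φ t) x)
    (F' := fun x => -p * ((1 - 2 * jacAt oX oY φ x) ^ (p / 2 - 1) * jacVariation oX oY Φ x))
    (x₀ := (0 : ℝ)) (bound := fun _ => (B : ℝ)) (s := Metric.ball 0 (min δ ε))
    (Metric.ball_mem_nhds _ (lt_min hδ hV.pos)) ?_ ?_ ?_ ?_ ?_ ?_).2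
  · simp only [energy_eq]
    rw [restrict_interior_eq hM]
    rw [integral_const_mul] at key
    exact key.const_mul _
  · filter_upwards [Ioo_mem_nhds h0.1 h0.2] with t ht
    exact (hcont t ht).aestronglyMeasurable hmI
  -- At `t = 0` the base `1 - 2J` lies between `1/2` and `1`.
  · refine Integrable.of_bound ((hcont 0 h0).aestronglyMeasurable hmI) 1 ?_
    refine (ae_restrict_iff' hmI).2 (Filter.Eventually.of_forall fun x hx => ?_)
    have hk := hK0 x hx
    rw [energyDensity, hk.sqDist_eq, Real.norm_of_nonneg
      (Real.rpow_nonneg (by linarith [hk.2.2]) _)]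
    exact Real.rpow_le_one (by linarith [hk.2.2]) (by linarith [hk.2.1]) (by positivity)
  · refine ContinuousOn.aestronglyMeasurable (fun x hx => ?_) hmI
    have hc : ContinuousAt (jacAt oX oY φ) x := by
      refine (continuousAt_jacAt oX oY (hjoint x hx)).congr ?_
      filter_upwards [isOpen_interior.mem_nhds hx] with z hz using hJ0 z hz
    refine ContinuousAt.continuousWithinAt (continuousAt_const.mul (ContinuousAt.mul ?_
      (continuousAt_jacVariation oX oY (hjoint x hx))))
    refine ContinuousAt.rpow_const (continuousAt_const.sub (continuousAt_const.mul hc)) (Or.inl ?_)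
    linarith [(hK x hx).2.2]
  · refine (ae_restrict_iff' hmI).2 (Filter.Eventually.of_forall fun x hx => ?_)
    by_cases hxC : x ∈ C
    · refine ((hB x hxC).mono (Metric.ball_subset_ball (min_le_left _ _))).weaken ?_
      simp
    -- Off `C` the family does not move, so the density is constant in time.
    · refine LipschitzOnWith.of_dist_le_mul fun a ha b hb => ?_
      rw [energyDensity_congr oX oY p (hout a (hball ha) x ⟨hx, hxC⟩),
        energyDensity_congr oX oY p (hout b (hball hb) x ⟨hx, hxC⟩), dist_self]
      positivity
  · exact integrable_const _
  · refine (ae_restrict_iff' hmI).2 (Filter.Eventually.of_forall fun x hx => ?_)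
    rw [← hJ0 x hx]
    exact hasDerivAt_energyDensity oX oY p (hjoint x hx) (hK0 x hx)

end EnergyDerivative

/-! ### Variations supported in a single chart -/

section Patches

variable {X : Type*} [TopologicalSpace X] [ChartedSpace Plane X] [IsManifold (𝓡 2) ∞ X]
  {Y : Type*} [TopologicalSpace Y] [ChartedSpace Plane Y] [IsManifold (𝓡 2) ∞ Y]

/-- The part of the chart domain at `x₀` that corresponds to `W`. -/
abbrev chartImage (x₀ : X) (W : Set X) : Set Plane :=
  (chartAt Plane x₀).target ∩ (chartAt Plane x₀).symm ⁻¹' W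

/-- The family does not move near `x`. -/
def StationaryAt (Φ : ℝ → X → Y) (x : X) : Prop := ∀ᶠ t in 𝓝 (0 : ℝ), Φ t =ᶠ[𝓝 x] Φ 0

theorem fluxField_eq_zero {Φ : ℝ → X → Y} {x₀ : X} {y₀ : Y} {u : Plane} {w : Plane → ℝ}
    (hu : u ∈ (chartAt Plane x₀).target) (h : JointC2At Φ 0 ((chartAt Plane x₀).symm u))
    (hy : Φ 0 ((chartAt Plane x₀).symm u) ∈ (chartAt Plane y₀).source)
    (hs : StationaryAt Φ ((chartAt Plane x₀).symm u)) (i : Fin 2) :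
    fluxField w (localMap x₀ y₀ Φ) i u = 0 := by
  have hd := ((h.contDiffAt_localMap hu hy).differentiableAt (by norm_num)).hasFDerivAt
  have hp : HasDerivAt (fun t : ℝ => (t, u)) ((1 : ℝ), (0 : Plane)) 0 :=
    (hasDerivAt_id _).prodMk (hasDerivAt_const _ _)
  have h1 := hd.comp_hasDerivAt (0 : ℝ) hp
  have h2 : localMap x₀ y₀ Φ ∘ (fun t : ℝ => (t, u)) =ᶠ[𝓝 0]
      fun _ => localMap x₀ y₀ Φ (0, u) := by
    filter_upwards [hs] with t ht
    simp [localMap, inCharts, ht.eq_of_nhds]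
  have h3 : fderiv ℝ (localMap x₀ y₀ Φ) (0, u) (1, 0) = 0 :=
    h1.unique ((hasDerivAt_const (0 : ℝ) _).congr_of_eventuallyEq h2)
  fin_cases i <;> simp [fluxField, pullbackArea, h3, det2]

/-- A family slowed down by the factor `χ`. -/
def slowdown (χ : X → ℝ) (Φ : ℝ → X → Y) (t : ℝ) (x : X) : Y := Φ (t * χ x) x

variable [Bundle.RiemannianBundle (fun x : X => TangentSpace (𝓡 2) x)]
  [Bundle.RiemannianBundle (fun y : Y => TangentSpace (𝓡 2) y)]

theorem jacVariation_eq_zero (oX : SurfaceOrientation X) (oY : SurfaceOrientation Y)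
    {Φ : ℝ → X → Y} {x : X} (h : StationaryAt Φ x) : jacVariation oX oY Φ x = 0 := by
  have h1 : (fun t => jacAt oX oY (Φ t) x) =ᶠ[𝓝 0] fun _ => jacAt oX oY (Φ 0) x := by
    filter_upwards [h] with t ht using jacAt_congr oX oY ht
  rw [jacVariation, h1.deriv_eq, deriv_const]

/-- An open part of a chart domain on which the component of the area form has the sign `s`, and
which is mapped into one chart domain. -/
structure IsPatch (oX : SurfaceOrientation X) (φ : X → Y) (x₀ : X) (y₀ : Y) (s : ℝ) (W : Set X) :
    Prop where
  isOpen : IsOpen W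
  subset_source : W ⊆ (chartAt Plane x₀).source
  mapsTo : ∀ x ∈ W, φ x ∈ (chartAt Plane y₀).source
  sign : ∀ u ∈ chartImage x₀ W, s * chartArea oX x₀ u = |chartArea oX x₀ u|

theorem exists_isPatch (oX : SurfaceOrientation X) {φ : X → Y} {O : Set X} (hO : IsOpen O) {x : X}
    (hx : x ∈ O) (hφ : ContinuousOn φ O) :
    ∃ s W, IsPatch oX φ x (φ x) s W ∧ x ∈ W ∧ W ⊆ O := by
  obtain ⟨s, hs, hev⟩ := eventually_chartArea_eq oX (mem_chart_target Plane x)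
  have hc : ContinuousAt (chartAt Plane x) x :=
    (chartAt Plane x).continuousAt (mem_chart_source Plane x)
  have h1 := (hφ.continuousAt (hO.mem_nhds hx)).preimage_mem_nhds
    ((chartAt Plane (φ x)).open_source.mem_nhds (mem_chart_source Plane (φ x)))
  have h2 := (chartAt Plane x).open_source.mem_nhds (mem_chart_source Plane x)
  have h3 := hc.preimage_mem_nhds hev
  obtain ⟨W, hW, hWo, hxW⟩ := mem_nhds_iff.1
    (Filter.inter_mem (Filter.inter_mem h1 h2) (Filter.inter_mem h3 (hO.mem_nhds hx)))
  refine ⟨s, W, ⟨hWo, fun z hz => (hW hz).1.2, fun z hz => (hW hz).1.1, ?_⟩, hxW,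
    fun z hz => (hW hz).2.2⟩
  rintro u ⟨hut, hu⟩
  have h4 : chartArea oX x u = s * √(chartArea oX x u ^ 2) := by
    have := (hW hu).2.1
    simpa [(chartAt Plane x).right_inv hut] using this
  rw [Real.sqrt_sq_eq_abs] at h4
  have hss : s * s = 1 := by rcases hs with rfl | rfl <;> norm_num
  calc s * chartArea oX x u = s * (s * |chartArea oX x u|) := by rw [← h4]
    _ = |chartArea oX x u| := by rw [← mul_assoc, hss, one_mul]

variable [IsContMDiffRiemannianBundle (𝓡 2) ∞ Plane (fun x : X => TangentSpace (𝓡 2) x)]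
  [IsContMDiffRiemannianBundle (𝓡 2) ∞ Plane (fun y : Y => TangentSpace (𝓡 2) y)]
  {oX : SurfaceOrientation X} {oY : SurfaceOrientation Y}
  {Φ : ℝ → X → Y} {x₀ : X} {y₀ : Y} {s : ℝ} {W : Set X}

theorem IsPatch.isOpen_chartImage (hW : IsPatch oX (Φ 0) x₀ y₀ s W) : IsOpen (chartImage x₀ W) :=
  (chartAt Plane x₀).isOpen_inter_preimage_symm hW.isOpen

theorem jacVariation_eq_div {u : Plane} (oX : SurfaceOrientation X) (oY : SurfaceOrientation Y)
    (hu : u ∈ (chartAt Plane x₀).target) (h : JointC2At Φ 0 ((chartAt Plane x₀).symm u))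
    (hy : Φ 0 ((chartAt Plane x₀).symm u) ∈ (chartAt Plane y₀).source) :
    jacVariation oX oY Φ ((chartAt Plane x₀).symm u) =
      div2 (fluxField (chartArea oY y₀) (localMap x₀ y₀ Φ)) u / chartArea oX x₀ u :=
  (hasDerivAt_jacAt_mul oX oY hu h hy).deriv

/-- The flux of a family, extended by zero outside a patch. -/
def patchFlux (oY : SurfaceOrientation Y) (Φ : ℝ → X → Y) (x₀ : X) (y₀ : Y) (W : Set X) (i : Fin 2) :
    Plane → ℝ :=
  (chartImage x₀ W).indicator (fluxField (chartArea oY y₀) (localMap x₀ y₀ Φ) i)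

theorem contDiffAt_fluxField_of_isPatch (oY : SurfaceOrientation Y)
    (hW : IsPatch oX (Φ 0) x₀ y₀ s W)
    (hΦ : ∀ x ∈ W, JointC2At Φ 0 x) {u : Plane} (hu : u ∈ chartImage x₀ W) (i : Fin 2) :
    ContDiffAt ℝ 1 (fluxField (chartArea oY y₀) (localMap x₀ y₀ Φ) i) u :=
  have hy := hW.mapsTo _ hu.2
  contDiffAt_fluxField ((hΦ _ hu.2).contDiffAt_localMap hu.1 hy)
    ((contDiffAt_chartArea oY (localMap_mem_target hy)).of_le (by exact_mod_cast le_top)) i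

variable {C : Set X}

theorem patchFlux_eq_zero (oY : SurfaceOrientation Y) (hW : IsPatch oX (Φ 0) x₀ y₀ s W)
    (hΦ : ∀ x ∈ W, JointC2At Φ 0 x) (hst : ∀ x ∈ W \ C, StationaryAt Φ x) {u : Plane}
    (hu : u ∉ chartAt Plane x₀ '' C) (i : Fin 2) : patchFlux oY Φ x₀ y₀ W i u = 0 := by
  by_cases hA : u ∈ chartImage x₀ W
  · rw [patchFlux, indicator_of_mem hA]
    refine fluxField_eq_zero hA.1 (hΦ _ hA.2) (hW.mapsTo _ hA.2) (hst _ ⟨hA.2, fun hC => hu ?_⟩) i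
    exact ⟨_, hC, (chartAt Plane x₀).right_inv hA.1⟩
  · exact indicator_of_notMem hA _

theorem isCompact_chart_image (hC : IsCompact C) (hCW : C ⊆ W)
    (hW : IsPatch oX (Φ 0) x₀ y₀ s W) : IsCompact (chartAt Plane x₀ '' C) :=
  hC.image_of_continuousOn ((chartAt Plane x₀).continuousOn.mono (hCW.trans hW.subset_source))

theorem chart_image_subset (hCW : C ⊆ W) (hW : IsPatch oX (Φ 0) x₀ y₀ s W) :
    chartAt Plane x₀ '' C ⊆ chartImage x₀ W := by
  rintro _ ⟨z, hz, rfl⟩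
  have hzs := hW.subset_source (hCW hz)
  exact ⟨(chartAt Plane x₀).map_source hzs, by
    rw [mem_preimage, (chartAt Plane x₀).left_inv hzs]; exact hCW hz⟩

theorem patchFlux_eventuallyEq (oY : SurfaceOrientation Y) (hW : IsPatch oX (Φ 0) x₀ y₀ s W)
    {u : Plane} (hu : u ∈ chartImage x₀ W) (i : Fin 2) : patchFlux oY Φ x₀ y₀ W i =ᶠ[𝓝 u]
      fluxField (chartArea oY y₀) (localMap x₀ y₀ Φ) i := by
  filter_upwards [hW.isOpen_chartImage.mem_nhds hu] with v hv
  rw [patchFlux, indicator_of_mem hv]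

theorem patchFlux_eventuallyEq_zero (oY : SurfaceOrientation Y) (hC : IsCompact C) (hCW : C ⊆ W)
    (hW : IsPatch oX (Φ 0) x₀ y₀ s W)
    (hΦ : ∀ x ∈ W, JointC2At Φ 0 x) (hst : ∀ x ∈ W \ C, StationaryAt Φ x) {u : Plane}
    (hu : u ∉ chartAt Plane x₀ '' C) (i : Fin 2) :
    patchFlux oY Φ x₀ y₀ W i =ᶠ[𝓝 u] fun _ => 0 := by
  filter_upwards [(isCompact_chart_image hC hCW hW).isClosed.isOpen_compl.mem_nhds hu] with v hv
  exact patchFlux_eq_zero oY hW hΦ hst hv i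

/-- Extension by zero creates no jump: the flux already vanishes off the chart image of `C`, a
compact subset of the open patch. -/
theorem contDiff_patchFlux (oY : SurfaceOrientation Y) (hC : IsCompact C) (hCW : C ⊆ W)
    (hW : IsPatch oX (Φ 0) x₀ y₀ s W)
    (hΦ : ∀ x ∈ W, JointC2At Φ 0 x) (hst : ∀ x ∈ W \ C, StationaryAt Φ x) (i : Fin 2) :
    ContDiff ℝ 1 (patchFlux oY Φ x₀ y₀ W i) := by
  rw [contDiff_iff_contDiffAt]
  intro u
  by_cases hu : u ∈ chartAt Plane x₀ '' C
  · have hA := chart_image_subset hCW hW hu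
    exact (contDiffAt_fluxField_of_isPatch oY hW hΦ hA i).congr_of_eventuallyEq
      (patchFlux_eventuallyEq oY hW hA i)
  · exact contDiffAt_const.congr_of_eventuallyEq
      (patchFlux_eventuallyEq_zero oY hC hCW hW hΦ hst hu i)

theorem hasCompactSupport_patchFlux (oY : SurfaceOrientation Y) (hC : IsCompact C) (hCW : C ⊆ W)
    (hW : IsPatch oX (Φ 0) x₀ y₀ s W)
    (hΦ : ∀ x ∈ W, JointC2At Φ 0 x) (hst : ∀ x ∈ W \ C, StationaryAt Φ x) (i : Fin 2) :
    HasCompactSupport (patchFlux oY Φ x₀ y₀ W i) :=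
  HasCompactSupport.intro (isCompact_chart_image hC hCW hW)
    fun _ hu => patchFlux_eq_zero oY hW hΦ hst hu i

variable [MeasurableSpace X] [BorelSpace X] [SecondCountableTopology X]

/-- The weighted variation of the area of a family that moves only inside a patch. -/
theorem setIntegral_mul_jacVariation (oY : SurfaceOrientation Y) (hC : IsCompact C) (hCW : C ⊆ W)
    (hW : IsPatch oX (Φ 0) x₀ y₀ s W)
    (hΦ : ∀ x ∈ W, JointC2At Φ 0 x) (hst : ∀ x ∈ W \ C, StationaryAt Φ x)
    {g : X → ℝ} (hg : ContinuousOn g W) :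
    ∫ x in W, g x * jacVariation oX oY Φ x ∂(riemannianVolume X) =
      s * ∫ u, g ((chartAt Plane x₀).symm u) * div2 (patchFlux oY Φ x₀ y₀ W) u := by
  have hA := hW.isOpen_chartImage.measurableSet
  have hc : ContinuousOn (fun x => g x * jacVariation oX oY Φ x) W :=
    hg.mul fun x hx => (continuousAt_jacVariation oX oY (hΦ x hx)).continuousWithinAt
  rw [setIntegral_of_subset_source oX hW.isOpen hW.subset_source hc, ← integral_const_mul,
    ← integral_indicator hA]
  congr 1
  ext u
  by_cases hu : u ∈ chartImage x₀ W
  -- `J'` is the divergence over the signed area component, and the measure has the absolute value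
  -- as density, so only the sign `s` remains.
  · rw [indicator_of_mem hu, jacVariation_eq_div oX oY hu.1 (hΦ _ hu.2) (hW.mapsTo _ hu.2),
      ← hW.sign u hu]
    have h1 : div2 (patchFlux oY Φ x₀ y₀ W) u =
        div2 (fluxField (chartArea oY y₀) (localMap x₀ y₀ Φ)) u := by
      rw [div2, div2, (patchFlux_eventuallyEq oY hW hu 0).fderiv_eq,
        (patchFlux_eventuallyEq oY hW hu 1).fderiv_eq]
    rw [h1]
    have := chartArea_ne_zero oX hu.1
    field_simp
  · rw [indicator_of_notMem hu]
    have hu' : u ∉ chartAt Plane x₀ '' C := fun h => hu (chart_image_subset hCW hW h)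
    have h1 : div2 (patchFlux oY Φ x₀ y₀ W) u = 0 := by
      rw [div2, (patchFlux_eventuallyEq_zero oY hC hCW hW hΦ hst hu' 0).fderiv_eq,
        (patchFlux_eventuallyEq_zero oY hC hCW hW hΦ hst hu' 1).fderiv_eq]
      simp
    rw [h1]
    ring

theorem setIntegral_jacVariation_patch (oY : SurfaceOrientation Y) (hC : IsCompact C)
    (hCW : C ⊆ W) (hW : IsPatch oX (Φ 0) x₀ y₀ s W)
    (hΦ : ∀ x ∈ W, JointC2At Φ 0 x) (hst : ∀ x ∈ W \ C, StationaryAt Φ x) :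
    ∫ x in W, jacVariation oX oY Φ x ∂(riemannianVolume X) = 0 := by
  have h := setIntegral_mul_jacVariation oY hC hCW hW hΦ hst (g := fun _ => 1) continuousOn_const
  simp only [one_mul] at h
  rw [h, integral_div2_eq_zero (contDiff_patchFlux oY hC hCW hW hΦ hst)
    (hasCompactSupport_patchFlux oY hC hCW hW hΦ hst), mul_zero]

end Patches

/-! ### The total signed area does not vary -/

section AreaVariation

variable {X : Type*} [TopologicalSpace X] [ChartedSpace Plane X] [IsManifold (𝓡 2) ∞ X]
  {Y : Type*} [TopologicalSpace Y] [ChartedSpace Plane Y] [IsManifold (𝓡 2) ∞ Y]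

theorem slowdown_zero (χ : X → ℝ) (Φ : ℝ → X → Y) : slowdown χ Φ 0 = Φ 0 := by
  ext x; simp [slowdown]

theorem slowdown_jointC2At {χ : X → ℝ} {Φ : ℝ → X → Y} {x : X} (h : JointC2At Φ 0 x)
    (hχ : ContMDiff (𝓡 2) 𝓘(ℝ, ℝ) ∞ χ) : JointC2At (slowdown χ Φ) 0 x := by
  have h1 : ContMDiffAt (𝓘(ℝ, ℝ).prod (𝓡 2)) 𝓘(ℝ, ℝ) 2 (fun q : ℝ × X => q.1 * χ q.2)
      ((0 : ℝ), x) :=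
    contMDiffAt_fst.mul
      (ContMDiffAt.comp ((0 : ℝ), x) (hχ.contMDiffAt.of_le ENat.LEInfty.out) contMDiffAt_snd)
  have h2 := h1.prodMk contMDiffAt_snd
  have h3 : ContMDiffAt (𝓘(ℝ, ℝ).prod (𝓡 2)) (𝓡 2) 2 (fun q : ℝ × X => Φ q.1 q.2)
      ((fun q : ℝ × X => (q.1 * χ q.2, q.2)) ((0 : ℝ), x)) := by
    simpa using h
  exact ContMDiffAt.comp ((0 : ℝ), x) h3 h2

variable [Bundle.RiemannianBundle (fun x : X => TangentSpace (𝓡 2) x)]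
  [Bundle.RiemannianBundle (fun y : Y => TangentSpace (𝓡 2) y)]
  [IsContMDiffRiemannianBundle (𝓡 2) ∞ Plane (fun x : X => TangentSpace (𝓡 2) x)]
  [IsContMDiffRiemannianBundle (𝓡 2) ∞ Plane (fun y : Y => TangentSpace (𝓡 2) y)]
  (oX : SurfaceOrientation X) (oY : SurfaceOrientation Y)

/-- The variation of the Jacobian is additive in the speed of the family. -/
theorem sum_jacVariation_slowdown {ι : Type*} (F : Finset ι) {χ : ι → X → ℝ} {Φ : ℝ → X → Y}
    {x : X} (h : JointC2At Φ 0 x) (hχ : ∀ i, ContMDiff (𝓡 2) 𝓘(ℝ, ℝ) ∞ (χ i))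
    (hsum : ∀ᶠ z in 𝓝 x, ∑ i ∈ F, χ i z = 1) :
    ∑ i ∈ F, jacVariation oX oY (slowdown (χ i) Φ) x = jacVariation oX oY Φ x := by
  have hxt := mem_chart_target Plane x
  have hl := (chartAt Plane x).left_inv (mem_chart_source Plane x)
  set u := chartAt Plane x x with hu
  -- All slowed-down families agree at time `0`, so one target chart serves them all.
  set y₀ := Φ 0 x with hy₀
  have hy : Φ 0 ((chartAt Plane x).symm u) ∈ (chartAt Plane y₀).source := by
    rw [hl]; exact mem_chart_source Plane _
  have h' : JointC2At Φ 0 ((chartAt Plane x).symm u) := by rwa [hl]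
  set Z := fluxField (chartArea oY y₀) (localMap x y₀ Φ) with hZ
  set c : ι → Plane → ℝ := fun i v => χ i ((chartAt Plane x).symm v) with hc
  have hcd : ∀ i, ∀ v ∈ (chartAt Plane x).target, DifferentiableAt ℝ (c i) v := fun i v hv => by
    rw [← mdifferentiableAt_iff_differentiableAt]
    exact ((hχ i).mdifferentiable (by norm_num) _).comp v (mdifferentiableAt_chart_symm hv)
  have hZd : ∀ k, DifferentiableAt ℝ (Z k) u := fun k =>
    (contDiffAt_fluxField (h'.contDiffAt_localMap hxt hy)
      ((contDiffAt_chartArea oY (localMap_mem_target hy)).of_le (by exact_mod_cast le_top))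
      k).differentiableAt (by norm_num)
  have hev : ∀ᶠ v in 𝓝 u, v ∈ (chartAt Plane x).target ∧
      DifferentiableAt ℝ (localMap x y₀ Φ) (0, v) := by
    have hcont : ContinuousAt (fun v : Plane => ((0 : ℝ), v)) u := by fun_prop
    filter_upwards [hcont.eventually (h'.eventually hxt hy)] with v hv
    exact ⟨hv.1, (hv.2.1.contDiffAt_localMap hv.1 hv.2.2).differentiableAt (by norm_num)⟩
  have hflux : ∀ i k, fluxField (chartArea oY y₀) (localMap x y₀ (slowdown (χ i) Φ)) k =ᶠ[𝓝 u]
      fun v => c i v * Z k v := fun i k => by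
    filter_upwards [hev] with v hv
    exact fluxField_slowdown hv.2 (hcd i v hv.1) k
  -- The cut-offs sum to one near `u`, not only at `u`, so their gradients cancel in the sum.
  have hfs : ∀ k, fderiv ℝ (Z k) u = ∑ i ∈ F, fderiv ℝ (fun v => c i v * Z k v) u := fun k => by
    rw [← fderiv_fun_sum (A := fun i v => c i v * Z k v) fun i _ => (hcd i u hxt).mul (hZd k)]
    refine Filter.EventuallyEq.fderiv_eq ?_
    have hcx : ContinuousAt (chartAt Plane x).symm u :=
      (chartAt Plane x).symm.continuousAt hxt
    have h2 : ∀ᶠ v in 𝓝 u, ∑ i ∈ F, c i v = 1 := by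
      refine hcx.eventually (p := fun z => ∑ i ∈ F, χ i z = 1) ?_
      rwa [hl]
    filter_upwards [h2] with v hv
    rw [← Finset.sum_mul, hv, one_mul]
  have hterm : ∀ i, jacVariation oX oY (slowdown (χ i) Φ) x =
      (fderiv ℝ (fun v => c i v * Z 0 v) u (stdVec 0) +
        fderiv ℝ (fun v => c i v * Z 1 v) u (stdVec 1)) / chartArea oX x u := fun i => by
    have h1 := jacVariation_eq_div (Φ := slowdown (χ i) Φ) (y₀ := y₀) oX oY hxt
      (slowdown_jointC2At h' (hχ i)) (by rw [slowdown_zero]; exact hy)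
    rw [hl] at h1
    rw [h1, div2, (hflux i 0).fderiv_eq, (hflux i 1).fderiv_eq]
  have hmain := jacVariation_eq_div (y₀ := y₀) oX oY hxt h' hy
  rw [hl] at hmain
  rw [hmain, div2, hfs 0, hfs 1]
  simp only [hterm]
  rw [← Finset.sum_div, Finset.sum_add_distrib]
  simp

theorem StationaryAt.slowdown_of_notMem {Φ : ℝ → X → Y} {χ : X → ℝ} {x : X} (hx : x ∉ tsupport χ) :
    StationaryAt (slowdown χ Φ) x := by
  refine Filter.Eventually.of_forall fun t => ?_
  filter_upwards [(isClosed_tsupport χ).isOpen_compl.mem_nhds hx] with z hz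
  simp [slowdown, image_eq_zero_of_notMem_tsupport hz]

variable [MeasurableSpace X] [BorelSpace X] [SecondCountableTopology X] [T2Space X]
  {M : Set X} {N : Set Y} {φ : X → Y} {ε : ℝ} {Φ : ℝ → X → Y}

/-- The Jacobian is a null Lagrangian: the signed area of the image does not vary. -/
theorem setIntegral_jacVariation_eq_zero (hφ : ContinuousOn φ (interior M))
    (hV : IsVariation M N φ ε Φ) :
    ∫ x in interior M, jacVariation oX oY Φ x ∂(riemannianVolume X) = 0 := by
  classical
  have : LocallyCompactSpace X := ChartedSpace.locallyCompactSpace Plane X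
  have : IsFiniteMeasureOnCompacts (riemannianVolume X) :=
    ⟨fun _ hK => riemannianVolume_lt_top oX hK⟩
  have hjoint : ∀ x ∈ interior M, JointC2At Φ 0 x := fun x hx => hV.jointC2At hV.zero_mem hx
  obtain ⟨C, hC, hCM, hout⟩ := hV.eq_outside
  -- The partition is required to sum to one on a compact neighbourhood of `C`, because the
  -- derivative of the sum is needed at points of `C`.
  obtain ⟨L, hL, hCL, hLM⟩ := exists_compact_between hC isOpen_interior hCM
  have hc0 : ContinuousOn (Φ 0) (interior M) :=
    hφ.congr fun x hx => hV.zero x (interior_subset hx)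
  choose s W hW hxW hWM using fun x : interior M =>
    exists_isPatch oX isOpen_interior x.2 hc0
  obtain ⟨f, hf⟩ := SmoothPartitionOfUnity.exists_isSubordinate (𝓡 2) hL.isClosed W
    (fun x => (hW x).isOpen) (fun x hx => mem_iUnion.2 ⟨⟨x, hLM hx⟩, hxW ⟨x, hLM hx⟩⟩)
  have hfin := f.locallyFinite.finite_nonempty_inter_compact hL
  set F := hfin.toFinset with hF
  have hsum : ∀ z ∈ L, ∑ i ∈ F, f i z = 1 := by
    intro z hz
    rw [← f.sum_eq_one hz, finsum_eq_sum_of_support_subset]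
    intro i hi
    rw [hF, Finset.mem_coe, Set.Finite.mem_toFinset]
    exact ⟨z, hi, hz⟩
  have hstat : ∀ i, ∀ x ∈ interior M \ (C ∩ tsupport (f i)), StationaryAt (slowdown (f i) Φ) x := by
    intro i x hx
    by_cases hxC : x ∈ C
    · exact StationaryAt.slowdown_of_notMem fun h => hx.2 ⟨hxC, h⟩
    · filter_upwards [Ioo_mem_nhds hV.zero_mem.1 hV.zero_mem.2] with t ht
      filter_upwards [(isOpen_interior.sdiff hC.isClosed).mem_nhds ⟨hx.1, hxC⟩] with z hz
      have hzM : z ∈ M \ C := ⟨interior_subset hz.1, hz.2⟩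
      have h1 := f.nonneg i z
      have h2 := f.le_one i z
      -- Cut-offs have values in `[0, 1]`, so the slowed time stays in the interval of the
      -- variation.
      have htz : t * f i z ∈ Ioo (-ε) ε := by
        rw [mem_Ioo, ← abs_lt] at ht ⊢
        rw [abs_mul, abs_of_nonneg h1]
        exact (mul_le_of_le_one_right (abs_nonneg _) h2).trans_lt ht
      rw [slowdown_zero, slowdown, hout _ htz z hzM, hout _ hV.zero_mem z hzM]
  have hstatΦ : ∀ x ∈ interior M \ C, StationaryAt Φ x := by
    intro x hx
    filter_upwards [Ioo_mem_nhds hV.zero_mem.1 hV.zero_mem.2] with t ht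
    filter_upwards [(isOpen_interior.sdiff hC.isClosed).mem_nhds hx] with z hz
    have hzM : z ∈ M \ C := ⟨interior_subset hz.1, hz.2⟩
    rw [hout _ ht z hzM, hout _ hV.zero_mem z hzM]
  have hj : ∀ i, ∀ x ∈ interior M, JointC2At (slowdown (f i) Φ) 0 x := fun i x hx =>
    slowdown_jointC2At (hjoint x hx) (f i).contMDiff
  have hcont : ∀ i, ContinuousOn (jacVariation oX oY (slowdown (f i) Φ)) (interior M) :=
    fun i x hx => (continuousAt_jacVariation oX oY (hj i x hx)).continuousWithinAt
  have hcomp : ∀ i, IsCompact (C ∩ tsupport (f i)) := fun i => hC.inter_right (isClosed_tsupport _)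
  -- Each slowed family moves only in `C ∩ tsupport (f i)`, a compact subset of one patch, where the
  -- divergence theorem applies.
  have hzero : ∀ i, ∫ x in interior M, jacVariation oX oY (slowdown (f i) Φ) x
      ∂(riemannianVolume X) = 0 := by
    intro i
    have hCW : C ∩ tsupport (f i) ⊆ W i := fun x hx => hf i hx.2
    rw [setIntegral_eq_of_subset_of_forall_sdiff_eq_zero isOpen_interior.measurableSet (hWM i)]
    · refine setIntegral_jacVariation_patch oY (hcomp i) hCW (x₀ := i.1) (y₀ := Φ 0 i.1) (s := s i)
        ?_ (fun x hx => hj i x (hWM i hx)) fun x hx => hstat i x ⟨hWM i hx.1, hx.2⟩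
      rw [slowdown_zero]
      exact hW i
    · exact fun x hx => jacVariation_eq_zero oX oY (hstat i x ⟨hx.1, fun h => hx.2 (hCW h)⟩)
  have hint : ∀ i, IntegrableOn (jacVariation oX oY (slowdown (f i) Φ)) (interior M)
      (riemannianVolume X) := fun i =>
    IntegrableOn.of_forall_sdiff_eq_zero
      (((hcont i).mono (inter_subset_left.trans hCM)).integrableOn_compact (hcomp i))
      isOpen_interior.measurableSet fun x hx => jacVariation_eq_zero oX oY (hstat i x hx)
  have hpt : ∀ x ∈ interior M, jacVariation oX oY Φ x =
      ∑ i ∈ F, jacVariation oX oY (slowdown (f i) Φ) x := by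
    intro x hx
    by_cases hxC : x ∈ C
    · refine (sum_jacVariation_slowdown oX oY F (hjoint x hx) (fun i => (f i).contMDiff) ?_).symm
      filter_upwards [mem_interior_iff_mem_nhds.1 (hCL hxC)] with z hz using hsum z hz
    · rw [jacVariation_eq_zero oX oY (hstatΦ x ⟨hx, hxC⟩), Finset.sum_eq_zero]
      exact fun i _ => jacVariation_eq_zero oX oY (hstat i x ⟨hx, fun h => hxC h.1⟩)
  rw [setIntegral_congr_fun isOpen_interior.measurableSet hpt, integral_finsetSum _
    fun i _ => hint i]
  exact Finset.sum_eq_zero fun i _ => hzero i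

end AreaVariation

/-! ### Inner variations: moving the argument in a chart -/

section Shift

/-- The flux of the family obtained by moving the argument of `F` in a coordinate direction. -/
theorem fluxField_shift {w : Plane → ℝ} {ψ : ℝ × Plane → Plane} {F : Plane → Plane}
    {h : Plane → ℝ} {u : Plane} {i : Fin 2} (hF : DifferentiableAt ℝ F u)
    (hh : DifferentiableAt ℝ h u)
    (hψ : ψ =ᶠ[𝓝 ((0 : ℝ), u)] fun q => F (q.2 + (q.1 * h q.2) • stdVec i)) (k : Fin 2) :
    fluxField w ψ k u = if k = i then
      h u * (det2 (fderiv ℝ F u (stdVec 0)) (fderiv ℝ F u (stdVec 1)) * w (F u)) else 0 := by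
  have h1 : HasFDerivAt (fun q : ℝ × Plane => q.1 * h q.2)
      ((0 : ℝ) • (fderiv ℝ h u).comp (ContinuousLinearMap.snd ℝ ℝ Plane) +
        h u • ContinuousLinearMap.fst ℝ ℝ Plane) ((0 : ℝ), u) :=
    (hasFDerivAt_fst (𝕜 := ℝ) (p := ((0 : ℝ), u))).mul
      ((hh.hasFDerivAt (x := u)).comp ((0 : ℝ), u) hasFDerivAt_snd)
  have h2 := (hasFDerivAt_snd (𝕜 := ℝ) (p := ((0 : ℝ), u))).fun_add (h1.smul_const (stdVec i))
  have h3 : HasFDerivAt F (fderiv ℝ F u)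
      ((fun q : ℝ × Plane => q.2 + (q.1 * h q.2) • stdVec i) (0, u)) := by
    simpa using hF.hasFDerivAt
  have h4 := (HasFDerivAt.comp ((0 : ℝ), u) h3 h2).fderiv
  have h5 : ∀ ξ : ℝ × Plane, fderiv ℝ ψ (0, u) ξ =
      fderiv ℝ F u ξ.2 + (ξ.1 * h u) • fderiv ℝ F u (stdVec i) := by
    intro ξ
    rw [hψ.fderiv_eq]
    have := congrArg (fun L : ℝ × Plane →L[ℝ] Plane => L ξ) h4
    simp only [Function.comp_def] at this
    rw [this, ← map_smul, ← map_add]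
    simp [mul_comm]
  have h6 : ψ (0, u) = F u := by rw [hψ.eq_of_nhds]; simp
  -- The velocity is `h ∂ᵢF`. For `k ≠ i` the determinant pairs it with `∂ᵢF` itself and vanishes.
  fin_cases k <;> fin_cases i <;> simp [fluxField, pullbackArea, h5, h6, det2] <;>
    first | ring1 | (right; ring1)

variable {X : Type*} [TopologicalSpace X] [ChartedSpace Plane X] [IsManifold (𝓡 2) ∞ X]
  {Y : Type*} [TopologicalSpace Y] [ChartedSpace Plane Y] [IsManifold (𝓡 2) ∞ Y]

theorem jointC2At_const {φ : X → Y} {x : X} (h : ContMDiffAt (𝓡 2) (𝓡 2) 2 φ x) (t : ℝ) :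
    JointC2At (fun _ => φ) t x :=
  ContMDiffAt.comp (t, x) h contMDiffAt_snd

open Classical in
/-- The variation of `φ` that moves the argument in the direction `v` of a chart. -/
def chartShift (φ : X → Y) (x₀ : X) (W : Set X) (h : Plane → ℝ) (v : Plane) (t : ℝ) (x : X) : Y :=
  if x ∈ W then φ ((chartAt Plane x₀).symm (chartAt Plane x₀ x + (t * h (chartAt Plane x₀ x)) • v))
  else φ x

variable {φ : X → Y} {x₀ : X} {W : Set X} {h : Plane → ℝ} {v : Plane}

theorem chartShift_of_eq_zero (hWs : W ⊆ (chartAt Plane x₀).source) {t : ℝ} {x : X}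
    (hx : x ∈ W → t * h (chartAt Plane x₀ x) = 0) : chartShift φ x₀ W h v t x = φ x := by
  by_cases hxW : x ∈ W
  · rw [chartShift, if_pos hxW, hx hxW, zero_smul, add_zero,
      (chartAt Plane x₀).left_inv (hWs hxW)]
  · rw [chartShift, if_neg hxW]

theorem chartShift_zero (hWs : W ⊆ (chartAt Plane x₀).source) : chartShift φ x₀ W h v 0 = φ :=
  funext fun _ => chartShift_of_eq_zero hWs fun _ => zero_mul _

theorem chartShift_of_notMem (hWs : W ⊆ (chartAt Plane x₀).source) {t : ℝ} {x : X}
    (hx : x ∉ (chartAt Plane x₀).symm '' tsupport h) : chartShift φ x₀ W h v t x = φ x := by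
  refine chartShift_of_eq_zero hWs fun hxW => ?_
  rw [image_eq_zero_of_notMem_tsupport fun hm => hx ⟨_, hm, (chartAt Plane x₀).left_inv (hWs hxW)⟩,
    mul_zero]

/-- The compact support of `h` has a `δ`-thickening inside `A`, and other points do not move. The `+
1` in the bound `δ / (B‖v‖ + 1)` avoids division by zero. -/
theorem exists_shift_mem {A : Set Plane} (hA : IsOpen A) (hh : Continuous h)
    (hc : HasCompactSupport h) (hs : tsupport h ⊆ A) (v : Plane) :
    ∃ ε > 0, ∀ t ∈ Ioo (-ε) ε, ∀ u ∈ A, u + (t * h u) • v ∈ A := by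
  obtain ⟨δ, hδ, hsub⟩ := IsCompact.exists_thickening_subset_open hc hA hs
  obtain ⟨B, hB⟩ := hc.exists_bound_of_continuous hh
  have hB0 : 0 ≤ B := (norm_nonneg _).trans (hB 0)
  have hpos : 0 < B * ‖v‖ + 1 := by positivity
  refine ⟨δ / (B * ‖v‖ + 1), by positivity, fun t ht u hu => ?_⟩
  by_cases hut : u ∈ tsupport h
  · refine hsub (Metric.mem_thickening_iff.2 ⟨u, hut, ?_⟩)
    rw [dist_eq_norm, add_sub_cancel_left, norm_smul, norm_mul]
    have h1 : ‖t‖ * (B * ‖v‖ + 1) < δ := by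
      rw [← lt_div_iff₀ hpos, Real.norm_eq_abs, abs_lt]
      exact ht
    calc ‖t‖ * ‖h u‖ * ‖v‖ ≤ ‖t‖ * B * ‖v‖ := by gcongr; exact hB u
      _ ≤ ‖t‖ * (B * ‖v‖ + 1) := by nlinarith [norm_nonneg t]
      _ < δ := h1
  · rwa [image_eq_zero_of_notMem_tsupport hut, mul_zero, zero_smul, add_zero]

/-- For small times the family is `φ` after a self-map of `M`, so it stays in `N` whatever `N` is.
-/
theorem isVariation_chartShift [T2Space X] {M : Set X} {N : Set Y} (hφN : MapsTo φ M N)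
    (hφ : ContMDiffOn (𝓡 2) (𝓡 2) 2 φ M) (hWo : IsOpen W)
    (hWs : W ⊆ (chartAt Plane x₀).source) (hWM : W ⊆ interior M) (hh : ContDiff ℝ ∞ h)
    (hc : HasCompactSupport h) (hs : tsupport h ⊆ chartImage x₀ W) (v : Plane) :
    ∃ ε, IsVariation M N φ ε (chartShift φ x₀ W h v) := by
  obtain ⟨ε, hε, hmem⟩ := exists_shift_mem
    ((chartAt Plane x₀).isOpen_inter_preimage_symm hWo) hh.continuous hc hs v
  have hC : IsCompact ((chartAt Plane x₀).symm '' tsupport h) :=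
    IsCompact.image_of_continuousOn hc
      ((chartAt Plane x₀).symm.continuousOn.mono fun u hu => (hs hu).1)
  have hCW : (chartAt Plane x₀).symm '' tsupport h ⊆ W := by
    rintro _ ⟨u, hu, rfl⟩
    exact (hs hu).2
  have himg : ∀ x ∈ W, chartAt Plane x₀ x ∈ chartImage x₀ W := fun x hx =>
    ⟨(chartAt Plane x₀).map_source (hWs hx), by
      rw [mem_preimage, (chartAt Plane x₀).left_inv (hWs hx)]; exact hx⟩
  refine ⟨ε, hε, ?_, ?_, fun x _ => chartShift_of_eq_zero hWs fun _ => zero_mul _,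
    ⟨_, hC, hCW.trans hWM, fun t _ x hx => chartShift_of_notMem hWs hx.2⟩⟩
  · rintro ⟨t, x⟩ ⟨ht, hx⟩
    by_cases hxW : x ∈ W
    · refine ContMDiffAt.contMDiffWithinAt ?_
      have hm := hmem t ht _ (himg x hxW)
      have h1 : ContMDiffAt (𝓘(ℝ, ℝ).prod (𝓡 2)) 𝓘(ℝ, Plane) 2
          (fun q : ℝ × X => chartAt Plane x₀ q.2) (t, x) :=
        ContMDiffAt.comp (t, x) (((contMDiffOn_chart (n := ∞)).contMDiffAt
          ((chartAt Plane x₀).open_source.mem_nhds (hWs hxW))).of_le ENat.LEInfty.out)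
          contMDiffAt_snd
      have h2 : ContMDiffAt (𝓘(ℝ, ℝ).prod (𝓡 2)) 𝓘(ℝ, ℝ) 2
          (fun q : ℝ × X => q.1 * h (chartAt Plane x₀ q.2)) (t, x) :=
        contMDiffAt_fst.mul (ContMDiffAt.comp (t, x)
          ((hh.of_le ENat.LEInfty.out).contMDiff.contMDiffAt) h1)
      have h3 : ContMDiffAt (𝓘(ℝ, ℝ).prod (𝓡 2)) 𝓘(ℝ, Plane) 2
          (fun q : ℝ × X => chartAt Plane x₀ q.2 + (q.1 * h (chartAt Plane x₀ q.2)) • v) (t, x) :=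
        h1.add (h2.smul contMDiffAt_const)
      have h4 : ContMDiffAt (𝓡 2) (𝓡 2) 2 (chartAt Plane x₀).symm
          (chartAt Plane x₀ x + (t * h (chartAt Plane x₀ x)) • v) :=
        ((contMDiffOn_chart_symm (n := ∞)).contMDiffAt
          ((chartAt Plane x₀).open_target.mem_nhds hm.1)).of_le ENat.LEInfty.out
      have h5 : ContMDiffAt (𝓡 2) (𝓡 2) 2 φ ((chartAt Plane x₀).symm
          (chartAt Plane x₀ x + (t * h (chartAt Plane x₀ x)) • v)) :=
        hφ.contMDiffAt (mem_interior_iff_mem_nhds.1 (hWM hm.2))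
      refine (ContMDiffAt.comp (t, x) h5 (ContMDiffAt.comp (t, x) h4 h3)).congr_of_eventuallyEq ?_
      have hev : ∀ᶠ q : ℝ × X in 𝓝 (t, x), q.2 ∈ W :=
        continuousAt_snd.eventually (hWo.mem_nhds hxW)
      filter_upwards [hev] with q hq
      simp [chartShift, hq]
    -- The definition switches at the edge of `W`, but the complement of the moving compact set is
    -- an open set on which both branches are `φ`.
    · have hxC : x ∉ (chartAt Plane x₀).symm '' tsupport h := fun hm => hxW (hCW hm)
      have h1 : ContMDiffWithinAt (𝓘(ℝ, ℝ).prod (𝓡 2)) (𝓡 2) 2 (fun q : ℝ × X => φ q.2)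
          (Ioo (-ε) ε ×ˢ M) (t, x) :=
        ContMDiffWithinAt.comp (t, x) (hφ x hx) contMDiffWithinAt_snd fun q hq => hq.2
      have hev : ∀ᶠ q : ℝ × X in 𝓝 (t, x), q.2 ∉ (chartAt Plane x₀).symm '' tsupport h :=
        (hC.isClosed.isOpen_compl.preimage continuous_snd).mem_nhds hxC
      refine h1.congr_of_eventuallyEq ?_ (chartShift_of_notMem hWs hxC)
      filter_upwards [nhdsWithin_le_nhds hev] with q hq using chartShift_of_notMem hWs hq
  · intro t ht x hx
    by_cases hxW : x ∈ W
    · rw [chartShift, if_pos hxW]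
      exact hφN (interior_subset (hWM (hmem t ht _ (himg x hxW)).2))
    · rw [chartShift, if_neg hxW]
      exact hφN hx

end Shift

/-! ### Critical points and the weight `(1 - 2J)^(p/2 - 1)` -/

section CriticalPoints

variable {X : Type*} [TopologicalSpace X] [ChartedSpace Plane X] [IsManifold (𝓡 2) ∞ X]
  {Y : Type*} [TopologicalSpace Y] [ChartedSpace Plane Y] [IsManifold (𝓡 2) ∞ Y]
  [Bundle.RiemannianBundle (fun x : X => TangentSpace (𝓡 2) x)]
  [Bundle.RiemannianBundle (fun y : Y => TangentSpace (𝓡 2) y)]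
  [IsContMDiffRiemannianBundle (𝓡 2) ∞ Plane (fun x : X => TangentSpace (𝓡 2) x)]
  [IsContMDiffRiemannianBundle (𝓡 2) ∞ Plane (fun y : Y => TangentSpace (𝓡 2) y)]
  {oX : SurfaceOrientation X} {oY : SurfaceOrientation Y}
  {φ : X → Y} {x₀ : X} {y₀ : Y} {s : ℝ} {W : Set X} {h : Plane → ℝ}

/-- The coordinate determinant times the target area component is the Jacobian times the domain one,
so the flux is `h` times a nonvanishing factor wherever `J > 0`. -/
theorem patchFlux_chartShift (oY : SurfaceOrientation Y) (hW : IsPatch oX φ x₀ y₀ s W)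
    (hφ : ∀ x ∈ W, ContMDiffAt (𝓡 2) (𝓡 2) 2 φ x) (hh : ContDiff ℝ ∞ h)
    (hs : tsupport h ⊆ chartImage x₀ W) (i k : Fin 2) :
    patchFlux oY (chartShift φ x₀ W h (stdVec i)) x₀ y₀ W k = fun u => if k = i then
      h u * (jacAt oX oY φ ((chartAt Plane x₀).symm u) * chartArea oX x₀ u) else 0 := by
  have hA : IsOpen (chartImage x₀ W) :=
    (chartAt Plane x₀).isOpen_inter_preimage_symm hW.isOpen
  ext u
  by_cases hu : u ∈ chartImage x₀ W
  · have hmd : MDifferentiableAt (𝓡 2) (𝓡 2) φ ((chartAt Plane x₀).symm u) :=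
      (hφ _ hu.2).mdifferentiableAt (by norm_num)
    rw [patchFlux, indicator_of_mem hu, jacAt, jac_mul_chartArea oX oY hu.1 hmd (hW.mapsTo _ hu.2)]
    refine fluxField_shift (differentiableAt_inCharts hu.1 hmd (hW.mapsTo _ hu.2))
      (hh.differentiable (by norm_num) u) ?_ k
    have hev : ∀ᶠ q : ℝ × Plane in 𝓝 ((0 : ℝ), u), q.2 ∈ chartImage x₀ W :=
      (hA.preimage continuous_snd).mem_nhds hu
    have hev2 : ∀ᶠ q : ℝ × Plane in 𝓝 ((0 : ℝ), u),
        q.2 + (q.1 * h q.2) • stdVec i ∈ chartImage x₀ W := by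
      have hc : ContinuousAt (fun q : ℝ × Plane => q.2 + (q.1 * h q.2) • stdVec i) ((0 : ℝ), u) := by
        have := hh.continuous
        fun_prop
      refine hc.preimage_mem_nhds (hA.mem_nhds ?_)
      simpa using hu
    filter_upwards [hev, hev2] with q hq hq2
    have hqW : (chartAt Plane x₀).symm q.2 ∈ W := hq.2
    simp only [localMap, inCharts, chartShift, if_pos hqW, (chartAt Plane x₀).right_inv hq.1]
  · rw [patchFlux, indicator_of_notMem hu,
      image_eq_zero_of_notMem_tsupport fun hm => hu (hs hm)]
    simp

variable [MeasurableSpace X] [BorelSpace X] [SecondCountableTopology X] [T2Space X]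
  {M : Set X} {N : Set Y}

theorem IsCriticalPoint.setIntegral_eq_zero (hM : IsCompactSurface M) {p : ℝ} (hp : 0 < p)
    (hK : ∀ x ∈ interior M, InWellAt oX oY φ x) (hcrit : IsCriticalPoint oX oY M N p φ)
    {ε : ℝ} {Φ : ℝ → X → Y} (hV : IsVariation M N φ ε Φ) :
    ∫ x in interior M, (1 - 2 * jacAt oX oY φ x) ^ (p / 2 - 1) * jacVariation oX oY Φ x
      ∂(riemannianVolume X) = 0 := by
  have h1 := (hcrit ε Φ hV).unique (hasDerivAt_energy oX oY hM hp hK hV)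
  have hpos : 0 < (riemannianVolume X).real M := by
    refine ENNReal.toReal_pos ?_ (riemannianVolume_lt_top oX hM.isCompact).ne
    exact ((riemannianVolume_pos oX isOpen_interior hM.isConnected_interior.nonempty).trans_le
      (measure_mono interior_subset)).ne'
  have h2 : ((riemannianVolume X).real M)⁻¹ ≠ 0 := inv_ne_zero hpos.ne'
  have h3 : -p ≠ 0 := by linarith
  rcases mul_eq_zero.1 h1.symm with h | h
  · exact absurd h h2
  · exact (mul_eq_zero.1 h).resolve_left h3

theorem contMDiffAt_of_mem_interior (hφ : ContMDiffOn (𝓡 2) (𝓡 2) 2 φ M) {x : X}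
    (hx : x ∈ interior M) : ContMDiffAt (𝓡 2) (𝓡 2) 2 φ x :=
  hφ.contMDiffAt (mem_interior_iff_mem_nhds.1 hx)

theorem contDiffAt_jacAt_symm (oX : SurfaceOrientation X) (oY : SurfaceOrientation Y) {u : Plane}
    (hu : u ∈ (chartAt Plane x₀).target)
    (hφ : ContMDiffAt (𝓡 2) (𝓡 2) 2 φ ((chartAt Plane x₀).symm u)) :
    ContDiffAt ℝ 1 (fun u => jacAt oX oY φ ((chartAt Plane x₀).symm u)) u := by
  have h1 := contDiffAt_jacAt oX oY hu (jointC2At_const hφ 0)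
  have h2 : ContDiffAt ℝ 1 (fun u : Plane => ((0 : ℝ), u)) u := by fun_prop
  exact h1.comp u h2

/-- At a critical point, a function of the Jacobian is stationary: weak form. -/
theorem integral_fderiv_weight_eq_zero (hM : IsCompactSurface M) {p : ℝ} (hp : 0 < p)
    (hφN : MapsTo φ M N) (hφ : ContMDiffOn (𝓡 2) (𝓡 2) 2 φ M)
    (hK : ∀ x ∈ interior M, InWellAt oX oY φ x) (hcrit : IsCriticalPoint oX oY M N p φ)
    (hW : IsPatch oX φ x₀ y₀ s W) (hs : s ≠ 0) (hWM : W ⊆ interior M) (i : Fin 2)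
    (hh : ContDiff ℝ ∞ h) (hc : HasCompactSupport h) (hsupp : tsupport h ⊆ chartImage x₀ W) :
    ∫ u, h u * (fderiv ℝ (fun u => (1 - 2 * jacAt oX oY φ ((chartAt Plane x₀).symm u)) ^
      (p / 2 - 1)) u (stdVec i) *
      (jacAt oX oY φ ((chartAt Plane x₀).symm u) * chartArea oX x₀ u)) = 0 := by
  have hA : IsOpen (chartImage x₀ W) :=
    (chartAt Plane x₀).isOpen_inter_preimage_symm hW.isOpen
  set Φ := chartShift φ x₀ W h (stdVec i) with hΦ
  have hΦ0 : Φ 0 = φ := chartShift_zero hW.subset_source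
  obtain ⟨ε, hV⟩ := isVariation_chartShift hφN hφ hW.isOpen hW.subset_source hWM hh hc hsupp
    (stdVec i)
  set C := (chartAt Plane x₀).symm '' tsupport h with hCdef
  have hC : IsCompact C := IsCompact.image_of_continuousOn hc
    ((chartAt Plane x₀).symm.continuousOn.mono fun u hu => (hsupp hu).1)
  have hCW : C ⊆ W := by
    rintro _ ⟨u, hu, rfl⟩
    exact (hsupp hu).2
  have hW' : IsPatch oX (Φ 0) x₀ y₀ s W := by rwa [hΦ0]
  have hφW : ∀ x ∈ W, ContMDiffAt (𝓡 2) (𝓡 2) 2 φ x := fun x hx =>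
    contMDiffAt_of_mem_interior hφ (hWM hx)
  have hjoint : ∀ x ∈ W, JointC2At Φ 0 x := fun x hx => hV.jointC2At hV.zero_mem (hWM hx)
  have hst : ∀ x ∉ C, StationaryAt Φ x := fun x hx => by
    refine Filter.Eventually.of_forall fun t => ?_
    filter_upwards [hC.isClosed.isOpen_compl.mem_nhds hx] with z hz
    rw [hΦ0]
    exact chartShift_of_notMem hW.subset_source hz
  set G : Plane → ℝ := fun u => (1 - 2 * jacAt oX oY φ ((chartAt Plane x₀).symm u)) ^ (p / 2 - 1)
    with hG
  have hGd : ∀ u ∈ chartImage x₀ W, ContDiffAt ℝ 1 G u := fun u hu => by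
    refine ContDiffAt.rpow_const_of_ne (contDiffAt_const.sub
      (contDiffAt_const.mul (contDiffAt_jacAt_symm oX oY hu.1 (hφW _ hu.2)))) ?_
    linarith [(hK _ (hWM hu.2)).2.2]
  set P : Plane → ℝ := fun u =>
    h u * (jacAt oX oY φ ((chartAt Plane x₀).symm u) * chartArea oX x₀ u) with hP
  have hPflux : ∀ k, patchFlux oY Φ x₀ y₀ W k = fun u => if k = i then P u else 0 := fun k =>
    patchFlux_chartShift oY hW hφW hh hsupp i k
  have hPi : patchFlux oY Φ x₀ y₀ W i = P := by rw [hPflux i]; simp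
  have hPd : ContDiff ℝ 1 P := by
    rw [← hPi]
    exact contDiff_patchFlux oY hC hCW hW' hjoint (fun x hx => hst x hx.2) i
  have hPc : HasCompactSupport P := by
    rw [← hPi]
    exact hasCompactSupport_patchFlux oY hC hCW hW' hjoint (fun x hx => hst x hx.2) i
  have hP0 : ∀ u ∉ tsupport h, P =ᶠ[𝓝 u] fun _ => 0 := fun u hu => by
    filter_upwards [(isClosed_tsupport h).isOpen_compl.mem_nhds hu] with v hv
    simp [hP, image_eq_zero_of_notMem_tsupport hv]
  have hdiv : ∀ u, div2 (patchFlux oY Φ x₀ y₀ W) u = fderiv ℝ P u (stdVec i) := fun u => by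
    rw [div2, hPflux 0, hPflux 1]
    fin_cases i <;> simp
  have hgc : ContinuousOn (fun x => (1 - 2 * jacAt oX oY φ x) ^ (p / 2 - 1)) W := fun x hx => by
    have hc : ContinuousAt (jacAt oX oY φ) x :=
      continuousAt_jacAt oX oY (jointC2At_const (hφW x hx) 0)
    refine (ContinuousAt.rpow_const (continuousAt_const.sub (continuousAt_const.mul hc))
      (Or.inl ?_)).continuousWithinAt
    change (1 : ℝ) - 2 * jacAt oX oY φ x ≠ 0
    linarith [(hK x (hWM hx)).2.2]
  have hint : ∫ u, G u * fderiv ℝ P u (stdVec i) = 0 := by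
    have h1 := hcrit.setIntegral_eq_zero hM hp hK hV
    rw [setIntegral_eq_of_subset_of_forall_sdiff_eq_zero isOpen_interior.measurableSet hWM
      fun x hx => by
        rw [jacVariation_eq_zero oX oY (hst x fun hm => hx.2 (hCW hm)), mul_zero],
      setIntegral_mul_jacVariation oY hC hCW hW' hjoint (fun x hx => hst x hx.2) hgc] at h1
    simp only [hdiv] at h1
    exact (mul_eq_zero.1 h1).resolve_left hs
  -- `G` is regular only on the patch, while `P` vanishes near every point off `tsupport h`. This
  -- dichotomy makes their products regular on the whole plane.
  have hcases : ∀ u, u ∈ chartImage x₀ W ∨ u ∉ tsupport h := fun u =>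
    (em (u ∈ tsupport h)).imp (fun hu => hsupp hu) id
  have hGP : ContDiff ℝ 1 (fun u => G u * P u) := by
    rw [contDiff_iff_contDiffAt]
    intro u
    rcases hcases u with hu | hu
    · exact (hGd u hu).mul hPd.contDiffAt
    · refine contDiffAt_const (c := (0 : ℝ)).congr_of_eventuallyEq ?_
      filter_upwards [hP0 u hu] with v hv
      rw [hv, mul_zero]
  have hprod : ∀ u, fderiv ℝ (fun u => G u * P u) u (stdVec i) =
      G u * fderiv ℝ P u (stdVec i) + fderiv ℝ G u (stdVec i) * P u := fun u => by
    rcases hcases u with hu | hu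
    · rw [fderiv_fun_mul ((hGd u hu).differentiableAt (by norm_num))
        (hPd.differentiable (by norm_num) u)]
      simp [mul_comm]
    · have h1 : (fun u => G u * P u) =ᶠ[𝓝 u] fun _ => 0 := by
        filter_upwards [hP0 u hu] with v hv
        rw [hv, mul_zero]
      rw [h1.fderiv_eq, (hP0 u hu).fderiv_eq, (hP0 u hu).eq_of_nhds]
      simp
  have hcont : Continuous (fun u => fderiv ℝ G u (stdVec i) * P u) := by
    rw [continuous_iff_continuousAt]
    intro u
    rcases hcases u with hu | hu
    · exact (((hGd u hu).fderiv_right (m := 0) (by norm_num)).continuousAt.clm_apply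
        continuousAt_const).mul hPd.continuous.continuousAt
    · refine (continuousAt_const (y := (0 : ℝ))).congr ?_
      filter_upwards [hP0 u hu] with v hv
      rw [hv, mul_zero]
  have hi1 : Integrable (fun u => fderiv ℝ G u (stdVec i) * P u) :=
    hcont.integrable_of_hasCompactSupport hPc.mul_left
  have hi2 : Integrable (fun u => fderiv ℝ (fun u => G u * P u) u (stdVec i)) := by
    refine Continuous.integrable_of_hasCompactSupport ?_ ?_
    · exact (hGP.continuous_fderiv (by norm_num)).clm_apply continuous_const
    · exact (HasCompactSupport.fderiv ℝ (hPc.mul_left (f := G))).comp_left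
        (g := fun L : Plane →L[ℝ] ℝ => L (stdVec i)) rfl
  have h3 := integral_fderiv_eq_zero hGP (hPc.mul_left (f := G)) (stdVec i)
  have h4 : ∫ u, (fderiv ℝ (fun u => G u * P u) u (stdVec i) - fderiv ℝ G u (stdVec i) * P u) =
      0 := by
    rw [← hint]
    congr 1
    ext u
    rw [hprod u]
    ring
  rw [integral_sub hi2 hi1, h3, zero_sub, neg_eq_zero] at h4
  rw [← h4]
  congr 1
  ext u
  rw [hP]
  ring

/-- At a critical point with `p ≠ 2` the Jacobian is locally constant. -/
theorem eventually_jacAt_eq (hM : IsCompactSurface M) {p : ℝ} (hp : 0 < p) (hp2 : p ≠ 2)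
    (hφN : MapsTo φ M N) (hφ : ContMDiffOn (𝓡 2) (𝓡 2) 2 φ M)
    (hK : ∀ x ∈ interior M, InWellAt oX oY φ x) (hJ : ∀ x ∈ interior M, 0 < jacAt oX oY φ x)
    (hcrit : IsCriticalPoint oX oY M N p φ) {x : X} (hx : x ∈ interior M) :
    ∀ᶠ z in 𝓝 x, jacAt oX oY φ z = jacAt oX oY φ x := by
  obtain ⟨s, W, hW, hxW, hWM⟩ := exists_isPatch oX isOpen_interior hx
    (hφ.continuousOn.mono interior_subset)
  have hA : IsOpen (chartImage x W) :=
    (chartAt Plane x).isOpen_inter_preimage_symm hW.isOpen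
  have hl := (chartAt Plane x).left_inv (mem_chart_source Plane x)
  have hxA : chartAt Plane x x ∈ chartImage x W :=
    ⟨mem_chart_target Plane x, by rw [mem_preimage, hl]; exact hxW⟩
  have hs : s ≠ 0 := by
    rintro rfl
    have h1 := hW.sign _ hxA
    rw [zero_mul, eq_comm, abs_eq_zero] at h1
    exact chartArea_ne_zero oX hxA.1 h1
  set G : Plane → ℝ := fun u => (1 - 2 * jacAt oX oY φ ((chartAt Plane x).symm u)) ^ (p / 2 - 1)
    with hG
  have hjd : ∀ u ∈ chartImage x W,
      ContDiffAt ℝ 1 (fun u => jacAt oX oY φ ((chartAt Plane x).symm u)) u := fun u hu =>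
    contDiffAt_jacAt_symm oX oY hu.1 (contMDiffAt_of_mem_interior hφ (hWM hu.2))
  have hGd : ∀ u ∈ chartImage x W, ContDiffAt ℝ 1 G u := fun u hu => by
    refine ContDiffAt.rpow_const_of_ne (contDiffAt_const.sub (contDiffAt_const.mul (hjd u hu))) ?_
    linarith [(hK _ (hWM hu.2)).2.2]
  have hpart : ∀ i, ∀ u ∈ chartImage x W, fderiv ℝ G u (stdVec i) = 0 := by
    intro i
    set f : Plane → ℝ := fun u => fderiv ℝ G u (stdVec i) *
      (jacAt oX oY φ ((chartAt Plane x).symm u) * chartArea oX x u) with hf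
    have hfc : ContinuousOn f (chartImage x W) := fun u hu => by
      refine ContinuousAt.continuousWithinAt (ContinuousAt.mul ?_ ((hjd u hu).continuousAt.mul
        (contDiffAt_chartArea oX hu.1).continuousAt))
      exact ((hGd u hu).fderiv_right (m := 0) (by norm_num)).continuousAt.clm_apply
        continuousAt_const
    -- The fundamental lemma of the calculus of variations; continuity of `f` then turns almost
    -- everywhere into everywhere.
    have hae : ∀ᵐ u ∂(volume : Measure Plane), u ∈ chartImage x W → f u = 0 := by
      refine hA.ae_eq_zero_of_integral_contDiff_smul_eq_zero
        (hfc.locallyIntegrableOn hA.measurableSet) fun h hh hc hsupp => ?_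
      exact integral_fderiv_weight_eq_zero hM hp hφN hφ hK hcrit hW hs hWM i hh hc hsupp
    have heq : EqOn f (fun _ => 0) (chartImage x W) :=
      Measure.eqOn_open_of_ae_eq ((ae_restrict_iff' hA.measurableSet).2 hae) hA hfc
        continuousOn_const
    intro u hu
    have h1 := heq hu
    have h2 : jacAt oX oY φ ((chartAt Plane x).symm u) * chartArea oX x u ≠ 0 :=
      mul_ne_zero (hJ _ (hWM hu.2)).ne' (chartArea_ne_zero oX hu.1)
    exact (mul_eq_zero.1 h1).resolve_right h2
  obtain ⟨r, hr, hball⟩ := Metric.isOpen_iff.1 hA _ hxA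
  obtain ⟨a, ha⟩ := Metric.isOpen_ball.exists_is_const_of_fderiv_eq_zero (𝕜 := ℝ) (f := G)
    (convex_ball (chartAt Plane x x) r).isPreconnected
    (fun u hu => ((hGd u (hball hu)).differentiableAt (by norm_num)).differentiableWithinAt)
    (fun u hu => by
      ext v
      rw [eq_smul_stdVec v, map_add, map_smul, map_smul, hpart 0 u (hball hu),
        hpart 1 u (hball hu)]
      simp)
  have hc : ContinuousAt (chartAt Plane x) x :=
    (chartAt Plane x).continuousAt (mem_chart_source Plane x)
  have hne : p / 2 - 1 ≠ 0 := fun h => hp2 (by linarith)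
  filter_upwards [hc.preimage_mem_nhds (Metric.ball_mem_nhds _ hr),
    hW.isOpen.mem_nhds hxW] with z hz hzW
  have h1 := (ha _ hz).trans (ha _ (Metric.mem_ball_self hr)).symm
  simp only [hG, hl, (chartAt Plane x).left_inv (hW.subset_source hzW)] at h1
  -- This is where `p ≠ 2` enters: the exponent is nonzero, so the weight determines the Jacobian.
  rw [Real.rpow_left_inj (by linarith [(hK z (hWM hzW)).2.2]) (by linarith [(hK x hx).2.2]) hne]
    at h1
  linarith

theorem jacAt_eq_of_isCriticalPoint (hM : IsCompactSurface M) {p : ℝ} (hp : 0 < p) (hp2 : p ≠ 2)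
    (hφN : MapsTo φ M N) (hφ : ContMDiffOn (𝓡 2) (𝓡 2) 2 φ M)
    (hK : ∀ x ∈ interior M, InWellAt oX oY φ x) (hJ : ∀ x ∈ interior M, 0 < jacAt oX oY φ x)
    (hcrit : IsCriticalPoint oX oY M N p φ) {x z : X} (hx : x ∈ interior M)
    (hz : z ∈ interior M) : jacAt oX oY φ x = jacAt oX oY φ z :=
  hM.isConnected_interior.isPreconnected.induction₂
    (fun x z => jacAt oX oY φ x = jacAt oX oY φ z)
    (fun _ hx => nhdsWithin_le_nhds ((eventually_jacAt_eq hM hp hp2 hφN hφ hK hJ hcrit hx).mono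
      fun _ h => h.symm))
    (fun _ _ _ _ _ _ h1 h2 => h1.trans h2) (fun _ _ _ _ h => h.symm) hx hz

/-- The first variation vanishes as soon as the weight is constant. -/
theorem isCriticalPoint_of_weight_eq (hM : IsCompactSurface M) {p : ℝ} (hp : 0 < p)
    (hφ : ContMDiffOn (𝓡 2) (𝓡 2) 2 φ M) (hK : ∀ x ∈ interior M, InWellAt oX oY φ x) {c : ℝ}
    (hc : ∀ x ∈ interior M, (1 - 2 * jacAt oX oY φ x) ^ (p / 2 - 1) = c) :
    IsCriticalPoint oX oY M N p φ := by
  intro ε Φ hV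
  have h := hasDerivAt_energy oX oY hM hp hK hV
  have h1 : ∫ x in interior M, (1 - 2 * jacAt oX oY φ x) ^ (p / 2 - 1) * jacVariation oX oY Φ x
      ∂(riemannianVolume X) = 0 := by
    rw [setIntegral_congr_fun isOpen_interior.measurableSet
      (g := fun x => c * jacVariation oX oY Φ x) fun x hx => by simp only [hc x hx],
      integral_const_mul, setIntegral_jacVariation_eq_zero oX oY
        (hφ.continuousOn.mono interior_subset) hV, mul_zero]
  rwa [h1, mul_zero, mul_zero] at h

end CriticalPoints

end SurfaceElasticity

end

/-! ### Criticality and constancy of the singular values -/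

theorem proposition1p6
    {X : Type*} [TopologicalSpace X] [T2Space X] [SecondCountableTopology X]
    [ChartedSpace SurfaceElasticity.Plane X] [IsManifold (𝓡 2) ∞ X]
    [Bundle.RiemannianBundle (fun x : X => TangentSpace (𝓡 2) x)]
    [IsContMDiffRiemannianBundle (𝓡 2) ∞ SurfaceElasticity.Plane
      (fun x : X => TangentSpace (𝓡 2) x)]
    [MeasurableSpace X] [BorelSpace X]
    {Y : Type*} [TopologicalSpace Y] [T2Space Y] [SecondCountableTopology Y]
    [ChartedSpace SurfaceElasticity.Plane Y] [IsManifold (𝓡 2) ∞ Y]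
    [Bundle.RiemannianBundle (fun y : Y => TangentSpace (𝓡 2) y)]
    [IsContMDiffRiemannianBundle (𝓡 2) ∞ SurfaceElasticity.Plane
      (fun y : Y => TangentSpace (𝓡 2) y)]
    (oX : SurfaceElasticity.SurfaceOrientation X) (oY : SurfaceElasticity.SurfaceOrientation Y)
    (M : Set X) (hM : SurfaceElasticity.IsCompactSurface M) (N : Set Y)
    (φ : X → Y) (hφN : MapsTo φ M N) (hφ : ContMDiffOn (𝓡 2) (𝓡 2) 2 φ M)
    (hJ : ∀ x ∈ interior M, 0 < SurfaceElasticity.jac (oX.at_point x) (oY.at_point (φ x))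
      (SurfaceElasticity.diff φ x))
    (hK : ∀ x ∈ interior M, SurfaceElasticity.diff φ x ∈
      SurfaceElasticity.wellK (oX.at_point x) (oY.at_point (φ x))) :
    SurfaceElasticity.IsCriticalPoint oX oY M N 2 φ ∧
      ∀ p : ℝ, 0 < p → p ≠ 2 →
        (SurfaceElasticity.IsCriticalPoint oX oY M N p φ ↔
          SurfaceElasticity.HasConstantSingularValues M φ) := by
  have hK' : ∀ x ∈ interior M, SurfaceElasticity.InWellAt oX oY φ x := fun x hx =>
    SurfaceElasticity.inWellAt_of_mem_wellK oX oY (hK x hx)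
  have hJ' : ∀ x ∈ interior M, 0 < SurfaceElasticity.jacAt oX oY φ x := hJ
  -- For `p = 2` the exponent `p/2 - 1` is zero.
  refine ⟨SurfaceElasticity.isCriticalPoint_of_weight_eq hM two_pos hφ hK' (c := 1)
    fun x _ => by norm_num, fun p hp hp2 => ⟨fun hcrit => ?_, ?_⟩⟩
  · obtain ⟨x₁, hx₁⟩ := hM.isConnected_interior.nonempty
    have hc : ∀ x ∈ interior M, SurfaceElasticity.jacAt oX oY φ x =
        SurfaceElasticity.jacAt oX oY φ x₁ := fun x hx =>
      SurfaceElasticity.jacAt_eq_of_isCriticalPoint hM hp hp2 hφN hφ hK' hJ' hcrit hx hx₁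
    refine ⟨![(1 + √(1 - 4 * SurfaceElasticity.jacAt oX oY φ x₁)) / 2,
      (1 - √(1 - 4 * SurfaceElasticity.jacAt oX oY φ x₁)) / 2], fun x hx i => ?_⟩
    have h := SurfaceElasticity.singVal_eq_of_mem_wellK _ _ (hK x hx)
    rw [← hc x hx]
    fin_cases i
    · exact h.1
    · exact h.2
  · rintro ⟨s, hs⟩
    -- Since `J > 0`, it equals the product of the singular values, so the weight is constant too.
    refine SurfaceElasticity.isCriticalPoint_of_weight_eq hM hp hφ hK'
      (c := (1 - 2 * (s 0 * s 1)) ^ (p / 2 - 1)) fun x hx => ?_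
    have h := SurfaceElasticity.singVal_mul (oX.at_point x) (oY.at_point (φ x))
      (SurfaceElasticity.diff φ x)
    rw [hs x hx 0, hs x hx 1, abs_of_pos (hJ x hx)] at h
    rw [h, SurfaceElasticity.jacAt]
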